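/- Let $H$ be a real separable Hilbert space, identified with its dual, and let $V$ be a real reflexive Banach space that is continuously and densely embedded into $H$, so that $V\subseteq H\equiv H^*\subseteq V^*$. Let $\alpha>1$ and $\beta\in(0,1)$, and put $$\mathcal H=L^2([0,\infty);H),\qquad \mathcal V=L^\alpha([0,\infty);V)\cap L^2([0,\infty);H),\qquad \mathcal V^*=L^{\frac{\alpha}{\alpha-1}}([0,\infty);V^*)+L^2([0,\infty);H),$$ with norms $\|u\|_{\mathcal V}=\max(\|u\|_{L^\alpha([0,\infty);V)},\|u\|_{\mathcal H})$ and $\|u\|_{\mathcal V^*}=\inf\{\|u_1\|_{L^{\alpha/(\alpha-1)}([0,\infty);V^*)}+\|u_2\|_{\mathcal H}: u=u_1+u_2\}$. For $s\ge 0$ let $U_sf(r)=\mathbf 1_{[0,\infty)}(r-s)f(r-s)$ be the shift to the right on $\mathcal H$. For $t>0$ let $\eta_t^\beta$ be the one-sided $\beta$-stable law, that is, the probability measure on $[0,\infty)$ with $\int_0^\infty e^{-\lambda s}\,\eta^\beta_t(ds)=e^{-t\lambda^\beta}$ for all $\lambda\ge 0$, and let $U_t^\beta f=\int_0^\infty U_sf\,\eta_t^\beta(ds)$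 for $f\in\mathcal H$. Let $(\Lambda,D(\Lambda,\mathcal H))$ be the generator of $(U^\beta_t)_{t>0}$ on $\mathcal H$, and let $(\Lambda,\mathcal F)$ be the closure of $\Lambda\colon D(\Lambda,\mathcal H)\cap\mathcal V\to\mathcal V^*$ as an operator from $\mathcal V$ to $\mathcal V^*$. For $u\in L^1_{\mathrm{loc}}([0,\infty);V^*)$ (that is, $u\in L^1([0,T];V^*)$ for all $T\in(0,\infty)$) let $$(g_{1-\beta}*u)(t)=\frac1{\Gamma(1-\beta)}\int_0^t(t-s)^{-\beta}u(s)\,ds,$$ $$D(\partial_t^\beta)=\{u\in L^1_{\mathrm{loc}}([0,\infty);V^*) : g_{1-\beta}*u\in W^{1,1}([0,T];V^*)\text{ for all }T\in(0,\infty)\}.$$ **Proposition.** Let $u\in\mathcal F$. Then $u\in D(\partial_t^\beta)$ and $$\Lambda u=-\frac{d}{dt}(g_{1-\beta}*u),$$ where $\frac{d}{dt}$ is the weak derivative of the $V^*$-valued function $g_{1-\beta}*u$ on $(0,T)$, for every $T\in(0,\infty)$. Moreover $g_{1-\beta}*u\in C([0,\infty);H)$, that is, $g_{1-\beta}*u$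 agrees $dt$-a.e. on $[0,\infty)$ with a continuous function $[0,\infty)\to H$. -/

import Mathlib

section

open MeasureTheory ProbabilityTheory Filter Set Topology
open scoped ENNReal unitInterval ContDiff

namespace TimeFractional

/-! ### The one-sided stable semigroup of measures -/

/-- `φ` is, on `(0, ∞)`, the Laplace transform of the law of `-log X` for some random variable `X`
with values in `[0, 1]`. -/
def IsUnitMellin (φ : ℝ → ℝ) : Prop :=
  ∃ μ : ProbabilityMeasure I, ∀ l : ℝ, 0 < l → ∫ x, (x : ℝ) ^ l ∂(μ : Measure I) = φ l

lemma IsUnitMellin.mul {φ ψ : ℝ → ℝ} (hφ : IsUnitMellin φ) (hψ : IsUnitMellin ψ) :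
    IsUnitMellin (fun l => φ l * ψ l) := by
  obtain ⟨μ, hμ⟩ := hφ
  obtain ⟨ν, hν⟩ := hψ
  have hm : Measurable (fun p : I × I => p.1 * p.2) := by fun_prop
  refine ⟨⟨((μ : Measure I).prod (ν : Measure I)).map (fun p : I × I => p.1 * p.2),
    Measure.isProbabilityMeasure_map hm.aemeasurable⟩, fun l hl => ?_⟩
  have hc : Continuous (fun x : I => (x : ℝ) ^ l) :=
    continuous_subtype_val.rpow_const (fun _ => Or.inr hl.le)
  simp only [ProbabilityMeasure.coe_mk]
  rw [integral_map hm.aemeasurable hc.aestronglyMeasurable, ← hμ l hl, ← hν l hl,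
    ← integral_prod_mul]
  refine integral_congr_ae (Eventually.of_forall fun p => ?_)
  simpa using Real.mul_rpow p.1.2.1 p.2.2.1

lemma IsUnitMellin.pow {φ : ℝ → ℝ} (hφ : IsUnitMellin φ) (n : ℕ) :
    IsUnitMellin (fun l => φ l ^ n) := by
  induction n with
  | zero =>
    refine ⟨⟨Measure.dirac 1, inferInstance⟩, fun l hl => ?_⟩
    simp
  | succ n ih => simpa only [pow_succ] using ih.mul hφ

lemma IsUnitMellin.lim {φ : ℕ → ℝ → ℝ} {ψ : ℝ → ℝ} (hφ : ∀ n, IsUnitMellin (φ n))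
    (h : ∀ l : ℝ, 0 < l → Tendsto (fun n => φ n l) atTop (𝓝 (ψ l))) : IsUnitMellin ψ := by
  choose μ hμ using hφ
  let U : Ultrafilter ℕ := Ultrafilter.of atTop
  have hU : (U : Filter ℕ) ≤ atTop := Ultrafilter.of_le atTop
  obtain ⟨ν, -, hν⟩ := isCompact_univ.ultrafilter_le_nhds (U.map μ) (by simp)
  have hν' : Tendsto μ (U : Filter ℕ) (𝓝 ν) := hν
  refine ⟨ν, fun l hl => ?_⟩
  have hc : Continuous (fun x : I => (x : ℝ) ^ l) :=
    continuous_subtype_val.rpow_const (fun _ => Or.inr hl.le)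
  have h1 := (ProbabilityMeasure.tendsto_iff_forall_integral_tendsto.1 hν')
    (BoundedContinuousFunction.mkOfCompact ⟨_, hc⟩)
  have h2 : Tendsto (fun n => φ n l) (U : Filter ℕ) (𝓝 (ψ l)) := (h l hl).mono_left hU
  refine tendsto_nhds_unique h1 (h2.congr fun n => ?_)
  simp [← hμ n l hl]

/-- The kernel whose integral over `(0, ∞)` is the normalising constant of the stable law. -/
noncomputable def stableKernel (β u : ℝ) : ℝ := (1 - Real.exp (-u)) * u ^ (-(β + 1))

lemma integrableOn_stableKernel {β : ℝ} (h0 : 0 < β) (h1 : β < 1) :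
    IntegrableOn (stableKernel β) (Ioi 0) := by
  have hmeas : Measurable (stableKernel β) := by unfold stableKernel; fun_prop
  rw [← Ioc_union_Ioi_eq_Ioi zero_le_one]
  refine IntegrableOn.union ?_ ?_
  · have hi : IntegrableOn (fun u : ℝ => u ^ (-β)) (Ioc 0 1) :=
      (intervalIntegrable_iff_integrableOn_Ioc_of_le zero_le_one).1
        (intervalIntegral.intervalIntegrable_rpow' (by linarith))
    refine Integrable.mono' hi hmeas.aestronglyMeasurable ?_
    filter_upwards [ae_restrict_mem measurableSet_Ioc] with u hu
    have hu0 : 0 < u := hu.1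
    have e1 : 0 ≤ 1 - Real.exp (-u) := by
      have := Real.exp_le_one_iff.2 (by linarith : -u ≤ 0); linarith
    have e2 : 1 - Real.exp (-u) ≤ u := by have := Real.add_one_le_exp (-u); linarith
    have e3 : u ^ (-β) = u * u ^ (-(β + 1)) := by
      rw [← Real.rpow_one_add' hu0.le (by linarith)]; congr 1; ring
    rw [stableKernel, Real.norm_of_nonneg (by positivity), e3]
    gcongr
  · have hi : IntegrableOn (fun u : ℝ => u ^ (-(β + 1))) (Ioi 1) :=
      integrableOn_Ioi_rpow_of_lt (by linarith) zero_lt_one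
    refine Integrable.mono' hi hmeas.aestronglyMeasurable ?_
    filter_upwards [ae_restrict_mem measurableSet_Ioi] with u hu
    have hu0 : 0 < u := zero_lt_one.trans hu
    have e1 : 0 ≤ 1 - Real.exp (-u) := by
      have := Real.exp_le_one_iff.2 (by linarith : -u ≤ 0); linarith
    have e2 : 1 - Real.exp (-u) ≤ 1 := by have := Real.exp_pos (-u); linarith
    rw [stableKernel, Real.norm_of_nonneg (by positivity)]
    exact mul_le_of_le_one_left (by positivity) e2

lemma stableKernel_integral_pos {β : ℝ} (h0 : 0 < β) (h1 : β < 1) :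
    0 < ∫ u in Ioi (0 : ℝ), stableKernel β u := by
  have hpos : ∀ u ∈ Ioi (0 : ℝ), 0 < stableKernel β u := fun u hu => by
    have hu0 : 0 < u := hu
    have : Real.exp (-u) < 1 := by rw [Real.exp_lt_one_iff]; linarith
    have : 0 < 1 - Real.exp (-u) := by linarith
    unfold stableKernel; positivity
  rw [setIntegral_pos_iff_support_of_nonneg_ae
    ((ae_restrict_mem measurableSet_Ioi).mono fun u hu => (hpos u hu).le)
    (integrableOn_stableKernel h0 h1)]
  have : Function.support (stableKernel β) ∩ Ioi 0 = Ioi 0 :=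
    inter_eq_right.2 fun u hu => (hpos u hu).ne'
  simp [this]

lemma integral_pareto_exp {β : ℝ} (h0 : 0 < β) {a : ℝ} (ha : 0 < a) :
    ∫ s, Real.exp (-(a * |s|)) ∂(paretoMeasure 1 β)
      = 1 - β * a ^ β * ∫ u in Ioi a, stableKernel β u := by
  have := isProbabilityMeasure_paretoMeasure (zero_lt_one) h0
  have hint : Integrable (fun s : ℝ => Real.exp (-(a * |s|))) (paretoMeasure 1 β) := by
    refine Integrable.of_bound (C := 1) (by fun_prop) (Eventually.of_forall fun s => ?_)
    rw [Real.norm_of_nonneg (Real.exp_pos _).le, Real.exp_le_one_iff]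
    have : 0 ≤ a * |s| := by positivity
    linarith
  have e1 : ∫ s, (1 - Real.exp (-(a * |s|))) ∂(paretoMeasure 1 β)
      = β * a ^ β * ∫ u in Ioi a, stableKernel β u := by
    rw [paretoMeasure, integral_withDensity_eq_integral_toReal_smul
      (by unfold paretoPDF; fun_prop) (by simp [paretoPDF])]
    have e2 : (fun s : ℝ => (paretoPDF 1 β s).toReal • (1 - Real.exp (-(a * |s|))))
        = (Ici (1 : ℝ)).indicator (fun s => (β * a ^ (β + 1)) * stableKernel β (a * s)) := by
      funext s
      rw [paretoPDF, ENNReal.toReal_ofReal (paretoPDFReal_nonneg zero_le_one h0.le s)]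
      by_cases hs : 1 ≤ s
      · have hs0 : 0 < s := by linarith
        rw [indicator_of_mem (by exact hs), paretoPDFReal, if_pos hs, stableKernel,
          abs_of_pos hs0, Real.mul_rpow ha.le hs0.le, Real.rpow_neg ha.le]
        have : a ^ (β + 1) ≠ 0 := (Real.rpow_pos_of_pos ha _).ne'
        simp
        field_simp
      · rw [indicator_of_notMem (by exact hs), paretoPDFReal, if_neg hs]; simp
    rw [e2, integral_indicator measurableSet_Ici, integral_Ici_eq_integral_Ioi,
      integral_const_mul, integral_comp_mul_left_Ioi _ _ ha, mul_one,
      Real.rpow_add_one ha.ne']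
    simp only [smul_eq_mul]
    field_simp
  rw [← e1, integral_sub (integrable_const _) hint]
  simp

lemma isUnitMellin_pareto {β : ℝ} (h0 : 0 < β) {h : ℝ} (hh : 0 < h) :
    IsUnitMellin (fun l => 1 - β * (h * l) ^ β * ∫ u in Ioi (h * l), stableKernel β u) := by
  have := isProbabilityMeasure_paretoMeasure (zero_lt_one) h0
  let f : ℝ → I := fun s => ⟨Real.exp (-(h * |s|)), (Real.exp_pos _).le,
    Real.exp_le_one_iff.2 (by have : 0 ≤ h * |s| := by positivity
                              linarith)⟩
  have hf : Measurable f := Measurable.subtype_mk (by fun_prop)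
  refine ⟨⟨(paretoMeasure 1 β).map f, Measure.isProbabilityMeasure_map hf.aemeasurable⟩,
    fun l hl => ?_⟩
  have hc : Continuous (fun x : I => (x : ℝ) ^ l) :=
    continuous_subtype_val.rpow_const (fun _ => Or.inr hl.le)
  simp only [ProbabilityMeasure.coe_mk]
  rw [← integral_pareto_exp h0 (by positivity : 0 < h * l), integral_map hf.aemeasurable hc.aestronglyMeasurable]
  refine integral_congr_ae (Eventually.of_forall fun s => ?_)
  simp only [f]
  rw [← Real.exp_mul]
  congr 1; ring

lemma isUnitMellin_stable {β t : ℝ} (h0 : 0 < β) (h1 : β < 1) (ht : 0 < t) :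
    IsUnitMellin (fun l => Real.exp (-(t * l ^ β))) := by
  set K := ∫ u in Ioi (0 : ℝ), stableKernel β u with hK
  have hKpos : 0 < K := stableKernel_integral_pos h0 h1
  let h : ℕ → ℝ := fun n => (t / (β * K * (n + 1))) ^ (1 / β)
  have hbase : ∀ n : ℕ, 0 < t / (β * K * (n + 1)) := fun n => by positivity
  have hh : ∀ n, 0 < h n := fun n => Real.rpow_pos_of_pos (hbase n) _
  have hhβ : ∀ n, h n ^ β = t / (β * K * (n + 1)) := fun n => by
    rw [← Real.rpow_mul (hbase n).le, one_div_mul_cancel h0.ne', Real.rpow_one]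
  have hlim : Tendsto h atTop (𝓝 0) := by
    have : Tendsto (fun n : ℕ => t / (β * K * ((n : ℝ) + 1))) atTop (𝓝 0) := by
      refine Tendsto.div_atTop tendsto_const_nhds ?_
      exact (tendsto_atTop_add_const_right _ _ tendsto_natCast_atTop_atTop).const_mul_atTop
        (by positivity)
    have h2 := this.rpow_const (p := 1 / β) (Or.inr (by positivity))
    rwa [Real.zero_rpow (by positivity)] at h2
  refine IsUnitMellin.lim (φ := fun n l => (1 - β * (h n * l) ^ β *
    ∫ u in Ioi (h n * l), stableKernel β u) ^ (n + 1))
    (fun n => (isUnitMellin_pareto h0 (hh n)).pow (n + 1)) fun l hl => ?_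
  have hcov : Tendsto (fun n => ∫ u in Ioi (h n * l), stableKernel β u) atTop (𝓝 K) := by
    have hl0 : Tendsto (fun n => h n * l) atTop (𝓝 0) := by simpa using hlim.mul_const l
    have := (aecover_Ioi_of_Ioi (μ := volume) hl0).integral_tendsto_of_countably_generated
      (integrableOn_stableKernel h0 h1)
    refine this.congr fun n => ?_
    rw [Measure.restrict_restrict measurableSet_Ioi, inter_eq_left.2]
    exact Ioi_subset_Ioi (by have := hh n; positivity)
  let g : ℕ → ℝ := fun m => -(t * l ^ β / (K * m) * ∫ u in Ioi (h (m - 1) * l), stableKernel β u)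
  have hg : Tendsto (fun m : ℕ => (m : ℝ) * g m) atTop (𝓝 (-(t * l ^ β))) := by
    rw [← tendsto_add_atTop_iff_nat 1]
    have h3 := (hcov.const_mul (t * l ^ β / K)).neg
    rw [div_mul_cancel₀ _ hKpos.ne'] at h3
    refine h3.congr fun n => ?_
    simp only [g, Nat.add_sub_cancel]
    have : ((n + 1 : ℕ) : ℝ) ≠ 0 := by positivity
    field_simp
  have h4 := (tendsto_add_atTop_iff_nat 1).2 (Real.tendsto_one_add_pow_exp_of_tendsto hg)
  refine h4.congr fun n => ?_
  simp only [g, Nat.add_sub_cancel]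
  rw [Real.mul_rpow (hh n).le hl.le, hhβ n]
  congr 1
  push_cast
  rw [sub_eq_add_neg]
  field_simp

/-- `μ` is the law at time `t` of the one-sided `β`-stable semigroup: a probability measure carried
by `[0, ∞)` with Laplace transform `l ↦ exp (-t l ^ β)`. -/
structure IsOneSidedStable (β t : ℝ) (μ : Measure ℝ) : Prop where
  isProbabilityMeasure : IsProbabilityMeasure μ
  measure_Iio : μ (Iio 0) = 0
  laplace : ∀ l : ℝ, 0 ≤ l → ∫ s, Real.exp (-(l * s)) ∂μ = Real.exp (-(t * l ^ β))

theorem exists_isOneSidedStable {β t : ℝ} (h0 : 0 < β) (h1 : β < 1) (ht : 0 < t) :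
    ∃ μ : Measure ℝ, IsOneSidedStable β t μ := by
  obtain ⟨μ, hμ⟩ := isUnitMellin_stable h0 h1 ht
  have hf : Measurable (fun x : I => -Real.log (x : ℝ)) := by fun_prop
  have hz : (μ : Measure I) {0} = 0 := by
    have hL : Tendsto (fun n : ℕ => ∫ x : I, (x : ℝ) ^ (1 / ((n : ℝ) + 1)) ∂(μ : Measure I)) atTop
        (𝓝 (∫ x : I, ({0}ᶜ : Set I).indicator (fun _ => (1 : ℝ)) x ∂(μ : Measure I))) := by
      refine tendsto_integral_of_dominated_convergence (fun _ => 1) (fun n => ?_)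
        (integrable_const _) (fun n => Eventually.of_forall fun x => ?_)
        (Eventually.of_forall fun x => ?_)
      · exact (continuous_subtype_val.rpow_const
          (fun _ => Or.inr (by positivity))).aestronglyMeasurable
      · rw [Real.norm_of_nonneg (Real.rpow_nonneg x.2.1 _)]
        exact Real.rpow_le_one x.2.1 x.2.2 (by positivity)
      · by_cases hx : x = 0
        · subst hx
          simp only [mem_compl_iff, mem_singleton_iff, not_true_eq_false, not_false_eq_true,
            indicator_of_notMem]
          refine tendsto_const_nhds.congr fun n => ?_
          rw [Icc.coe_zero, Real.zero_rpow (by positivity)]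
        · rw [indicator_of_mem (by simpa using hx)]
          have hx0 : (x : ℝ) ≠ 0 := fun hc => hx (Subtype.ext hc)
          have := (Real.continuousAt_const_rpow hx0 (b := 0)).tendsto.comp
            (tendsto_one_div_add_atTop_nhds_zero_nat (𝕜 := ℝ))
          simpa [Function.comp_def] using this
    have hR : Tendsto (fun n : ℕ => ∫ x : I, (x : ℝ) ^ (1 / ((n : ℝ) + 1)) ∂(μ : Measure I)) atTop
        (𝓝 1) := by
      have h5 : Tendsto (fun n : ℕ => Real.exp (-(t * (1 / ((n : ℝ) + 1)) ^ β))) atTop (𝓝 1) := by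
        have := (tendsto_one_div_add_atTop_nhds_zero_nat (𝕜 := ℝ)).rpow_const (p := β)
          (Or.inr h0.le)
        rw [Real.zero_rpow h0.ne'] at this
        have := (Real.continuous_exp.tendsto _).comp (this.const_mul t).neg
        simpa [Function.comp_def] using this
      exact h5.congr fun n => (hμ _ (by positivity)).symm
    have h6 := tendsto_nhds_unique hL hR
    rw [integral_indicator_const _ (measurableSet_singleton _).compl] at h6
    have h7 : (μ : Measure I).real {0}ᶜ = 1 := by simpa using h6
    rw [probReal_compl_eq_one_sub (measurableSet_singleton _)] at h7
    exact (measureReal_eq_zero_iff).1 (by linarith)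
  have hnz : ∀ᵐ x ∂(μ : Measure I), x ≠ 0 := by
    rw [ae_iff]; simpa using hz
  have hP : IsProbabilityMeasure ((μ : Measure I).map (fun x : I => -Real.log (x : ℝ))) :=
    Measure.isProbabilityMeasure_map hf.aemeasurable
  refine ⟨(μ : Measure I).map (fun x : I => -Real.log (x : ℝ)), hP, ?_, fun l hl => ?_⟩
  · rw [Measure.map_apply hf measurableSet_Iio]
    convert measure_empty (μ := (μ : Measure I))
    ext x
    simpa using Real.log_nonpos x.2.1 x.2.2
  · rcases hl.eq_or_lt with rfl | hl
    · simp [Real.zero_rpow h0.ne']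
    · rw [integral_map hf.aemeasurable (by fun_prop)]
      refine Eq.trans ?_ (hμ l hl)
      refine integral_congr_ae (hnz.mono fun x hx => ?_)
      have hx0 : 0 < (x : ℝ) := lt_of_le_of_ne x.2.1 fun hc => hx (Subtype.ext hc.symm)
      simp only
      rw [Real.rpow_def_of_pos hx0]
      congr 1; ring

/-- The one-sided `β`-stable law `η_t^β` at time `t`. It exists for `0 < β < 1`, `t > 0`, and it is
unique, since a probability measure on `[0, ∞)` is determined by its Laplace transform. -/
noncomputable def stableLaw (β t : ℝ) : Measure ℝ :=
  open Classical in if h : ∃ μ : Measure ℝ, IsOneSidedStable β t μ then h.choose else 0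

theorem isOneSidedStable_stableLaw {β t : ℝ} (h0 : 0 < β) (h1 : β < 1) (ht : 0 < t) :
    IsOneSidedStable β t (stableLaw β t) := by
  have h := exists_isOneSidedStable h0 h1 ht
  rw [stableLaw, dif_pos h]
  exact h.choose_spec

/-! ### The subordinated shift semigroup on `L²([0, ∞); H)` and its generator -/

/-- Lebesgue measure `dt` on `[0, ∞)`. -/
noncomputable def halfLine : Measure ℝ := volume.restrict (Ici 0)

section Semigroup

variable {H : Type*} [NormedAddCommGroup H]

theorem memLp_shift (s : ℝ) (f : Lp H 2 halfLine) :
    MemLp (fun r => (Ici (0 : ℝ)).indicator (⇑f) (r - s)) 2 halfLine := by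
  have h1 : MemLp ((Ici (0 : ℝ)).indicator (⇑f)) 2 volume :=
    (memLp_indicator_iff_restrict measurableSet_Ici).2 (Lp.memLp f)
  exact (h1.comp_measurePreserving (measurePreserving_sub_right volume s)).restrict _

/-- The shift to the right `(U_s f)(r) = 1_{[0,∞)}(r - s) f(r - s)` on `L²([0, ∞); H)`. -/
noncomputable def shift (s : ℝ) (f : Lp H 2 halfLine) : Lp H 2 halfLine :=
  (memLp_shift s f).toLp _

variable [NormedSpace ℝ H]

/-- `U_t^β f = ∫ U_s f η_t^β(ds)`, a Bochner integral in `L²([0, ∞); H)`; the measure `η_t^β` is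
carried by `[0, ∞)`. -/
noncomputable def subordinatedShift (β t : ℝ) (f : Lp H 2 halfLine) : Lp H 2 halfLine :=
  ∫ s, shift s f ∂(stableLaw β t)

/-- `f` is in the domain of the generator of `(U_t^β)_{t > 0}` on `L²([0, ∞); H)`, and the generator
maps `f` to `w`. -/
def IsGeneratorValue (β : ℝ) (f w : Lp H 2 halfLine) : Prop :=
  Tendsto (fun t : ℝ => t⁻¹ • (subordinatedShift β t f - f)) (𝓝[>] 0) (𝓝 w)

end Semigroup

/-! ### The spaces `𝒱`, `𝒱*` and the closure of the generator as an operator from `𝒱` to `𝒱*`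

Elements of these spaces are represented by functions on `ℝ`, of which only the `dt`-class on
`[0, ∞)` matters. The inclusion of `V` into `H` is a continuous linear map `ι`. -/

section Gelfand

variable {V H : Type*} [NormedAddCommGroup V] [NormedSpace ℝ V]
  [NormedAddCommGroup H] [InnerProductSpace ℝ H]

/-- The embedding `H ≡ H* → V*`, `h ↦ (v ↦ ⟨h, ι v⟩_H)`. -/
noncomputable def toDual (ι : V →L[ℝ] H) (h : H) : StrongDual ℝ V := (innerSL ℝ h).comp ι

/-- `u ∈ 𝒱 = L^α([0, ∞); V) ∩ L²([0, ∞); H)`. -/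
structure MemV (ι : V →L[ℝ] H) (α : ℝ) (u : ℝ → V) : Prop where
  memLp : MemLp u (ENNReal.ofReal α) halfLine
  memLp_two : MemLp (fun t => ι (u t)) 2 halfLine

/-- The norm of `𝒱`. -/
noncomputable def normV (ι : V →L[ℝ] H) (α : ℝ) (u : ℝ → V) : ℝ≥0∞ :=
  max (eLpNorm u (ENNReal.ofReal α) halfLine) (eLpNorm (fun t => ι (u t)) 2 halfLine)

/-- `v = a + b` with `a ∈ L^{α/(α-1)}([0, ∞); V*)` and `b ∈ L²([0, ∞); H)`. -/
structure IsDecomp (ι : V →L[ℝ] H) (α : ℝ) (v : ℝ → StrongDual ℝ V)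
    (a : ℝ → StrongDual ℝ V) (b : ℝ → H) : Prop where
  memLp : MemLp a (ENNReal.ofReal (α / (α - 1))) halfLine
  memLp_two : MemLp b 2 halfLine
  ae_eq : ∀ᵐ t ∂halfLine, v t = a t + toDual ι (b t)

/-- `v ∈ 𝒱* = L^{α/(α-1)}([0, ∞); V*) + L²([0, ∞); H)`. -/
def MemVstar (ι : V →L[ℝ] H) (α : ℝ) (v : ℝ → StrongDual ℝ V) : Prop :=
  ∃ a b, IsDecomp ι α v a b

/-- The norm of `𝒱*`: the infimum of `‖a‖ + ‖b‖` over all decompositions `v = a + b`. -/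
noncomputable def normVstar (ι : V →L[ℝ] H) (α : ℝ) (v : ℝ → StrongDual ℝ V) : ℝ≥0∞ :=
  ⨅ (a : ℝ → StrongDual ℝ V) (b : ℝ → H) (_ : IsDecomp ι α v a b),
    eLpNorm a (ENNReal.ofReal (α / (α - 1))) halfLine + eLpNorm b 2 halfLine

/-- `u ∈ D(Λ, ℋ) ∩ 𝒱` and `Λ u = w ∈ ℋ = L²([0, ∞); H)`, where `Λ` is the generator of
`(U_t^β)_{t > 0}` on `ℋ`. -/
def IsLambda (ι : V →L[ℝ] H) (α β : ℝ) (u : ℝ → V) (w : Lp H 2 halfLine) : Prop :=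
  MemV ι α u ∧ ∃ f : Lp H 2 halfLine, (∀ᵐ t ∂halfLine, f t = ι (u t)) ∧ IsGeneratorValue β f w

/-- The pair `(u, v) ∈ 𝒱 × 𝒱*` lies in the closure, in `𝒱 × 𝒱*`, of the graph of
`Λ : D(Λ, ℋ) ∩ 𝒱 → 𝒱*`; that is, `u ∈ 𝓕` and `Λ u = v` for the closed operator `(Λ, 𝓕)`. -/
def IsClosureLambda (ι : V →L[ℝ] H) (α β : ℝ) (u : ℝ → V) (v : ℝ → StrongDual ℝ V) : Prop :=
  MemV ι α u ∧ MemVstar ι α v ∧ ∀ ε : ℝ≥0∞, 0 < ε →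
    ∃ (u' : ℝ → V) (w : Lp H 2 halfLine), IsLambda ι α β u' w ∧
      normV ι α (fun t => u' t - u t) < ε ∧
      normVstar ι α (fun t => toDual ι (w t) - v t) < ε

/-- `u ∈ 𝓕`, the domain of the closure of `Λ` as an operator from `𝒱` to `𝒱*`. -/
def MemF (ι : V →L[ℝ] H) (α β : ℝ) (u : ℝ → V) : Prop :=
  ∃ v : ℝ → StrongDual ℝ V, IsClosureLambda ι α β u v

end Gelfand

/-! ### The fractional derivative -/

section Fractional

variable {E : Type*} [NormedAddCommGroup E] [NormedSpace ℝ E]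

/-- The kernel `g_γ(t) = t^{γ-1} / Γ(γ)`, `t > 0`. -/
noncomputable def rlKernel (γ t : ℝ) : ℝ := t ^ (γ - 1) / Real.Gamma γ

/-- `(g_γ * f)(t) = ∫_0^t g_γ(t - s) f(s) ds`. -/
noncomputable def rlConv (γ : ℝ) (f : ℝ → E) (t : ℝ) : E :=
  ∫ s in (0 : ℝ)..t, rlKernel γ (t - s) • f s

/-- `w ∈ W^{1,1}([0, T]; E)` with weak derivative `w'`. -/
structure HasWeakDerivOn (T : ℝ) (w w' : ℝ → E) : Prop where
  integrableOn : IntegrableOn w (Icc 0 T)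
  integrableOn_deriv : IntegrableOn w' (Icc 0 T)
  integral_eq : ∀ φ : ℝ → ℝ, ContDiff ℝ ∞ φ → HasCompactSupport φ → tsupport φ ⊆ Ioo 0 T →
    ∫ t in Icc 0 T, deriv φ t • w t = -∫ t in Icc 0 T, φ t • w' t

/-- `f ∈ D(∂_t^β)`: `f` is integrable on bounded intervals and `g_{1-β} * f ∈ W^{1,1}([0, T]; E)`
for all `T ∈ (0, ∞)`. -/
structure MemCaputoDomain (β : ℝ) (f : ℝ → E) : Prop where
  integrableOn : ∀ T : ℝ, 0 < T → IntegrableOn f (Icc 0 T)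
  exists_weakDeriv : ∀ T : ℝ, 0 < T → ∃ w' : ℝ → E, HasWeakDerivOn T (rlConv (1 - β) f) w'

end Fractional

end TimeFractional

end

/-! Everything rests on the Laplace transform `L`. The transform of `U_t^β f` is `exp (-t l^β) L f`,
so differentiating at `t = 0` gives `L (Λ f) = -l^β L f` on the domain of the generator
(`IsGeneratorValue.laplaceIntegral_eq`). Since `exp (-l t)` lies in `L^α ∩ L²`, pairing with it is
continuous on `𝒱*`, and the identity survives the closure: `L v = -l^β L u` for `v = Λ u`
(`IsClosureLambda.laplaceIntegral_eq`). As `g_{1-β}` has transform `l^{β-1}` and integration from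
`0` multiplies by `l⁻¹`, the function `g_{1-β} * u + ∫_0^· v` has transform zero, and uniqueness
(`IsLaplaceIntegrable.ae_eq_zero`) makes it vanish a.e. Thus `g_{1-β} * u` is a primitive of `-v`,
which gives the weak derivative.

Continuity in `H` comes from an energy estimate on the differences of two approximants. If `w = Λ u`
lies in `L²(H)` and `W = ∫_0^· w`, then `‖W(t)‖² = 2 ∫_0^t ⟨w, W⟩ = -2 ∫_0^t ⟨w, g_{1-β} * u⟩`.
Splitting `w` as in `𝒱*` and applying Young's inequality bounds this on `[0, T]` by `2
‖g_{1-β}‖_{L¹(0,T)} ‖w‖_{𝒱*} ‖u‖_𝒱`. So the primitives of an approximating sequence are uniformly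
Cauchy in `H` on bounded intervals, and the limit is identified in `V*`. -/

section

open MeasureTheory ProbabilityTheory Filter Set Topology
open scoped ENNReal unitInterval ContDiff

namespace TimeFractional

/-! ### Laplace transforms on the half-line -/

section Laplace

variable {E : Type*} [NormedAddCommGroup E] [NormedSpace ℝ E]

/-- `f` has an absolutely convergent Laplace transform on `(0, ∞)`. -/
def IsLaplaceIntegrable (f : ℝ → E) : Prop :=
  ∀ l : ℝ, 0 < l → IntegrableOn (fun t => Real.exp (-(l * t)) • f t) (Ioi 0)

/-- The Laplace transform of `f`. -/
noncomputable def laplaceIntegral (f : ℝ → E) (l : ℝ) : E :=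
  ∫ t in Ioi 0, Real.exp (-(l * t)) • f t

lemma halfLine_eq : halfLine = volume.restrict (Ioi 0) :=
  (restrict_Ioi_eq_restrict_Ici).symm

lemma ae_halfLine_iff {p : ℝ → Prop} : (∀ᵐ t ∂halfLine, p t) ↔ ∀ᵐ t : ℝ, 0 < t → p t := by
  rw [halfLine_eq, ae_restrict_iff' measurableSet_Ioi]
  rfl

lemma memLp_exp_neg {l α : ℝ} (hl : 0 < l) (hα : 0 < α) :
    MemLp (fun t : ℝ => Real.exp (-(l * t))) (ENNReal.ofReal α) halfLine := by
  rw [halfLine_eq, ← integrable_norm_rpow_iff (by fun_prop) (by simpa using hα) (by simp),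
    ENNReal.toReal_ofReal hα.le]
  have h := integrableOn_exp_mul_Ioi (a := -(l * α)) (by simpa using mul_pos hl hα) 0
  refine h.congr_fun (fun t _ => ?_) measurableSet_Ioi
  simp only [Real.norm_eq_abs, Real.abs_exp]
  rw [← Real.exp_mul]
  congr 1; ring

lemma memLp_exp_neg_two {l : ℝ} (hl : 0 < l) :
    MemLp (fun t : ℝ => Real.exp (-(l * t))) 2 halfLine := by
  simpa using memLp_exp_neg hl (α := 2) two_pos

lemma isLaplaceIntegrable_of_memLp {f : ℝ → E} {p q : ℝ≥0∞} [p.HolderConjugate q]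
    (he : ∀ l : ℝ, 0 < l → MemLp (fun t : ℝ => Real.exp (-(l * t))) p halfLine)
    (hf : MemLp f q halfLine) : IsLaplaceIntegrable f := fun l hl => by
  have := memLp_one_iff_integrable.1 (hf.smul (r := 1) (he l hl))
  rwa [halfLine_eq] at this

lemma IsLaplaceIntegrable.add {f g : ℝ → E} (hf : IsLaplaceIntegrable f)
    (hg : IsLaplaceIntegrable g) : IsLaplaceIntegrable (fun t => f t + g t) := fun l hl => by
  simp only [smul_add]
  exact (hf l hl).add (hg l hl)

lemma IsLaplaceIntegrable.sub {f g : ℝ → E} (hf : IsLaplaceIntegrable f)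
    (hg : IsLaplaceIntegrable g) : IsLaplaceIntegrable (fun t => f t - g t) := fun l hl => by
  simp only [smul_sub]
  exact (hf l hl).sub (hg l hl)

lemma laplaceIntegral_congr {f g : ℝ → E} (h : ∀ᵐ t ∂halfLine, f t = g t) (l : ℝ) :
    laplaceIntegral f l = laplaceIntegral g l := by
  rw [halfLine_eq] at h
  exact integral_congr_ae (h.mono fun t ht => by simp only [ht])

lemma laplaceIntegral_add {f g : ℝ → E} (hf : IsLaplaceIntegrable f)
    (hg : IsLaplaceIntegrable g) {l : ℝ} (hl : 0 < l) :
    laplaceIntegral (fun t => f t + g t) l = laplaceIntegral f l + laplaceIntegral g l := by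
  simp only [laplaceIntegral, smul_add]
  exact integral_add (hf l hl) (hg l hl)

lemma laplaceIntegral_sub {f g : ℝ → E} (hf : IsLaplaceIntegrable f)
    (hg : IsLaplaceIntegrable g) {l : ℝ} (hl : 0 < l) :
    laplaceIntegral (fun t => f t - g t) l = laplaceIntegral f l - laplaceIntegral g l := by
  simp only [laplaceIntegral, smul_sub]
  exact integral_sub (hf l hl) (hg l hl)

lemma IsLaplaceIntegrable.integrableOn {f : ℝ → E} (hf : IsLaplaceIntegrable f) (T : ℝ) :
    IntegrableOn f (Icc 0 T) := by
  rw [integrableOn_Icc_iff_integrableOn_Ioc]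
  have h1 := (hf 1 one_pos).mono_set (Ioc_subset_Ioi_self : Ioc 0 T ⊆ Ioi 0)
  have h2 : IntegrableOn (fun t => Real.exp t • Real.exp (-(1 * t)) • f t) (Ioc 0 T) := by
    rw [← integrableOn_Icc_iff_integrableOn_Ioc] at h1 ⊢
    exact h1.continuousOn_smul (by fun_prop) isCompact_Icc
  refine h2.congr_fun (fun t _ => ?_) measurableSet_Ioc
  simp [smul_smul, ← Real.exp_add]

/-- A function on the half-line is determined by its Laplace transform. -/
theorem IsLaplaceIntegrable.ae_eq_zero [CompleteSpace E] {f : ℝ → E} (hf : IsLaplaceIntegrable f)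
    (h : ∀ l : ℝ, 0 < l → laplaceIntegral f l = 0) : ∀ᵐ t ∂halfLine, f t = 0 := by
  -- With the weight `exp (-t)` and the substitution `x = exp (-t)`, the transforms at the integers
  -- `l = n + 1` become the moments of `f` against `x ^ n`.
  set k : ℝ → E := fun t => Real.exp (-(1 * t)) • f t with hk
  have hki : IntegrableOn k (Ioi 0) := hf 1 one_pos
  have hpoly : ∀ p : Polynomial ℝ, IntegrableOn (fun t => p.eval (Real.exp (-t)) • k t) (Ioi 0) ∧
      ∫ t in Ioi 0, p.eval (Real.exp (-t)) • k t = 0 := by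
    intro p
    induction p using Polynomial.induction_on' with
    | add p q hp hq =>
      simp only [Polynomial.eval_add, add_smul]
      exact ⟨hp.1.add hq.1, by rw [integral_add hp.1 hq.1, hp.2, hq.2, add_zero]⟩
    | monomial n a =>
      have e : (fun t => (Polynomial.monomial n a).eval (Real.exp (-t)) • k t)
          = fun t => a • Real.exp (-(((n : ℝ) + 1) * t)) • f t := by
        funext t
        simp only [hk, Polynomial.eval_monomial, smul_smul]
        rw [← Real.exp_nat_mul, mul_assoc, ← Real.exp_add]
        congr 3; ring
      rw [e]
      refine ⟨(hf _ (by positivity)).smul a, ?_⟩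
      rw [integral_smul]
      have := h ((n : ℝ) + 1) (by positivity)
      rw [laplaceIntegral] at this
      rw [this, smul_zero]
  -- Weierstrass approximation on `[0, 1]`, integrated against the integrable `k`.
  have hcont : ∀ φ : ℝ → ℝ, Continuous φ → ∫ t in Ioi 0, φ (Real.exp (-t)) • k t = 0 := by
    intro φ hφ
    rw [← norm_le_zero_iff]
    refine le_of_forall_pos_le_add fun ε hε => ?_
    set K := ∫ t in Ioi 0, ‖k t‖ with hK
    have hK0 : 0 ≤ K := integral_nonneg fun _ => norm_nonneg _
    obtain ⟨p, hp⟩ := exists_polynomial_near_of_continuousOn 0 1 φ hφ.continuousOn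
      (ε / (K + 1)) (by positivity)
    have hb : ∀ᵐ t ∂volume.restrict (Ioi (0 : ℝ)),
        ‖(φ (Real.exp (-t)) - p.eval (Real.exp (-t))) • k t‖ ≤ ε / (K + 1) * ‖k t‖ := by
      filter_upwards [ae_restrict_mem measurableSet_Ioi] with t ht
      rw [norm_smul, Real.norm_eq_abs, abs_sub_comm]
      gcongr
      refine (hp _ ⟨(Real.exp_pos _).le, Real.exp_le_one_iff.2 ?_⟩).le
      have : (0 : ℝ) < t := ht
      linarith
    have hbi : IntegrableOn (fun t => ε / (K + 1) * ‖k t‖) (Ioi 0) := hki.norm.const_mul _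
    have hi : IntegrableOn (fun t => (φ (Real.exp (-t)) - p.eval (Real.exp (-t))) • k t) (Ioi 0) :=
      Integrable.mono' hbi (AEStronglyMeasurable.smul
        (by have := p.continuous; fun_prop) hki.aestronglyMeasurable) hb
    have e : ∫ t in Ioi 0, φ (Real.exp (-t)) • k t
        = ∫ t in Ioi 0, (φ (Real.exp (-t)) - p.eval (Real.exp (-t))) • k t := by
      have := integral_add hi (hpoly p).1
      simp only [sub_smul, sub_add_cancel] at this
      rw [this, (hpoly p).2, add_zero]
      simp only [sub_smul]
    rw [e]
    calc _ ≤ ∫ t in Ioi 0, ε / (K + 1) * ‖k t‖ := norm_integral_le_of_norm_le hbi hb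
      _ = ε / (K + 1) * K := integral_const_mul _ _
      _ ≤ 0 + ε := by
        rw [div_mul_eq_mul_div, zero_add]
        exact (div_le_iff₀ (by positivity)).2 (by nlinarith)
  have hloc := isOpen_Ioi.ae_eq_zero_of_integral_contDiff_smul_eq_zero (μ := volume)
    (f := k) hki.locallyIntegrableOn (U := Ioi (0 : ℝ)) (fun g hg hc hs => by
      have h0 : ∀ t, t ∉ Ioi (0 : ℝ) → g t • k t = 0 := fun t ht => by
        rw [image_eq_zero_of_notMem_tsupport (fun h => ht (hs h)), zero_smul]
      rw [← setIntegral_eq_integral_of_forall_compl_eq_zero h0]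
      obtain ⟨R, hR⟩ := hc.isBounded.subset_closedBall 0
      -- The cutoff keeps the argument of the logarithm away from `0`. It only acts for `t ≥ |R| +
      -- 1`, where `g` already vanishes.
      set φ : ℝ → ℝ := fun x => g (-Real.log (max x (Real.exp (-(|R| + 1))))) with hφ
      have hφc : Continuous φ := hg.continuous.comp (Continuous.neg (Continuous.log (by fun_prop)
        fun x => (lt_max_of_lt_right (Real.exp_pos _)).ne'))
      have := hcont φ hφc
      refine Eq.trans (integral_congr_ae (Eventually.of_forall fun t => ?_)) this
      simp only [hφ]
      congr 1
      rcases le_total (Real.exp (-(|R| + 1))) (Real.exp (-t)) with h1 | h1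
      · rw [max_eq_left h1, Real.log_exp, neg_neg]
      · rw [max_eq_right h1, Real.log_exp, neg_neg]
        have hz : ∀ s, |R| + 1 ≤ s → g s = 0 := fun s hs' => by
          refine image_eq_zero_of_notMem_tsupport fun h => ?_
          have := hR h
          rw [Metric.mem_closedBall, dist_zero_right, Real.norm_eq_abs] at this
          linarith [le_abs_self s, le_abs_self R]
        rw [hz _ le_rfl, hz]
        have := Real.exp_le_exp.1 h1
        linarith)
  rw [ae_halfLine_iff]
  filter_upwards [hloc] with t ht h0
  have := ht h0
  simpa [hk] using this

/-! ### Laplace transforms of fractional integrals -/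

section RiemannLiouville

variable {γ : ℝ}

lemma rlKernel_exp_integrable (hγ : 0 < γ) {l : ℝ} (hl : 0 < l) :
    IntegrableOn (fun t => Real.exp (-(l * t)) * rlKernel γ t) (Ioi 0) ∧
    ∫ t in Ioi 0, Real.exp (-(l * t)) * rlKernel γ t = (l ^ γ)⁻¹ := by
  have key := Real.integral_rpow_mul_exp_neg_mul_Ioi hγ hl
  have hΓ := Real.Gamma_pos_of_pos hγ
  have hint : IntegrableOn (fun t : ℝ => t ^ (γ - 1) * Real.exp (-(l * t))) (Ioi 0) :=
    -- A non-integrable function has integral `0` by convention, so the nonzero Gamma value already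
    -- proves integrability.
    .of_integral_ne_zero (by rw [key]; positivity)
  have e : (fun t => Real.exp (-(l * t)) * rlKernel γ t)
      = fun t => t ^ (γ - 1) * Real.exp (-(l * t)) / Real.Gamma γ := by
    funext t; rw [rlKernel]; ring
  rw [e]
  refine ⟨hint.div_const _, ?_⟩
  rw [integral_div, key, mul_div_assoc, div_self hΓ.ne', mul_one, one_div, Real.inv_rpow hl.le]

/-- The exponential weight is multiplicative, so it distributes over the two factors and leaves a
convolution of integrable functions, to which `posConvolution` applies. -/
lemma exp_smul_rlConv (f : ℝ → E) (l t : ℝ) :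
    Real.exp (-(l * t)) • rlConv γ f t = ∫ s in (0 : ℝ)..t,
      (ContinuousLinearMap.lsmul ℝ ℝ).flip (Real.exp (-(l * s)) • f s)
        (Real.exp (-(l * (t - s))) * rlKernel γ (t - s)) := by
  rw [rlConv, ← intervalIntegral.integral_smul]
  refine intervalIntegral.integral_congr fun s _ => ?_
  simp only [ContinuousLinearMap.flip_apply, ContinuousLinearMap.lsmul_apply, smul_smul]
  congr 1
  have : Real.exp (-(l * t)) = Real.exp (-(l * (t - s))) * Real.exp (-(l * s)) := by
    rw [← Real.exp_add]; congr 1; ring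
  rw [this]; ring

lemma isLaplaceIntegrable_rlConv (hγ : 0 < γ) {f : ℝ → E} (hf : IsLaplaceIntegrable f) :
    IsLaplaceIntegrable (rlConv γ f) := fun l hl => by
  have h := integrable_posConvolution (hf l hl) (rlKernel_exp_integrable hγ hl).1
    (ContinuousLinearMap.lsmul ℝ ℝ).flip
  rw [posConvolution, integrable_indicator_iff measurableSet_Ioi] at h
  simpa only [← exp_smul_rlConv] using h

lemma laplaceIntegral_rlConv [CompleteSpace E] (hγ : 0 < γ) {f : ℝ → E}
    (hf : IsLaplaceIntegrable f) {l : ℝ} (hl : 0 < l) :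
    laplaceIntegral (rlConv γ f) l = (l ^ γ)⁻¹ • laplaceIntegral f l := by
  have h := integral_posConvolution (hf l hl) (rlKernel_exp_integrable hγ hl).1
    (ContinuousLinearMap.lsmul ℝ ℝ).flip
  rw [(rlKernel_exp_integrable hγ hl).2] at h
  simp only [← exp_smul_rlConv] at h
  exact h

/-- This makes the primitive the case `γ = 1`, so that its transform follows from the general
formula. -/
lemma rlConv_one (f : ℝ → E) (t : ℝ) : rlConv 1 f t = ∫ s in (0 : ℝ)..t, f s := by
  simp [rlConv, rlKernel]

lemma rlConv_congr {f g : ℝ → E} (h : ∀ᵐ t ∂halfLine, f t = g t) {t : ℝ} (ht : 0 ≤ t) :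
    rlConv γ f t = rlConv γ g t := by
  rw [ae_halfLine_iff] at h
  refine intervalIntegral.integral_congr_ae (h.mono fun s hs hst => ?_)
  rw [uIoc_of_le ht] at hst
  rw [hs hst.1]

/-- If the Laplace transforms satisfy `L v = -l ^ β L f`, then `g_{1-β} * f` is the primitive of
`-v`. -/
theorem rlConv_eq_neg_primitive [CompleteSpace E] {β : ℝ} (hβ1 : β < 1)
    {f v : ℝ → E} (hf : IsLaplaceIntegrable f) (hv : IsLaplaceIntegrable v)
    (h : ∀ l : ℝ, 0 < l → laplaceIntegral v l = -(l ^ β • laplaceIntegral f l)) :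
    ∀ᵐ t ∂halfLine, rlConv (1 - β) f t = -∫ s in (0 : ℝ)..t, v s := by
  have hγ : 0 < 1 - β := by linarith
  have h1 := isLaplaceIntegrable_rlConv hγ hf
  have h2 := isLaplaceIntegrable_rlConv one_pos hv
  refine ((h1.add h2).ae_eq_zero fun l hl => ?_).mono fun t ht => ?_
  · rw [laplaceIntegral_add h1 h2 hl, laplaceIntegral_rlConv hγ hf hl,
      laplaceIntegral_rlConv one_pos hv hl, h l hl, smul_neg, smul_smul, ← sub_eq_add_neg,
      ← sub_smul, Real.rpow_sub hl, Real.rpow_one, inv_div, inv_mul_eq_div, sub_self, zero_smul]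
  · rw [rlConv_one] at ht
    exact eq_neg_of_add_eq_zero_left ht

end RiemannLiouville

end Laplace

/-! ### The Laplace transform of the generator -/

section Generator

variable {H : Type*} [NormedAddCommGroup H]

/-- Extension by zero and translation preserve the `L²` norm, and restriction does not increase it.
-/
lemma norm_shift_le (s : ℝ) (f : Lp H 2 halfLine) : ‖shift s f‖ ≤ ‖f‖ := by
  have h1 : MemLp ((Ici (0 : ℝ)).indicator (⇑f)) 2 volume :=
    (memLp_indicator_iff_restrict measurableSet_Ici).2 (Lp.memLp f)
  rw [shift, Lp.norm_toLp, Lp.norm_def]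
  refine ENNReal.toReal_mono (Lp.eLpNorm_ne_top f) ?_
  calc _ ≤ eLpNorm (fun r => (Ici (0 : ℝ)).indicator (⇑f) (r - s)) 2 volume :=
        eLpNorm_restrict_le _ _ _ _
    _ = eLpNorm ((Ici (0 : ℝ)).indicator (⇑f)) 2 volume :=
        eLpNorm_comp_measurePreserving (g := (Ici (0 : ℝ)).indicator (⇑f)) h1.aestronglyMeasurable
          (measurePreserving_sub_right volume s)
    _ = eLpNorm f 2 halfLine := eLpNorm_indicator_eq_eLpNorm_restrict measurableSet_Ici

variable [NormedSpace ℝ H]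

/-- Translations act continuously on `L²(ℝ; H)`; the shift extends by zero, translates and
restricts. This supplies the measurability behind the Bochner integral over `s`. -/
lemma continuous_shift (f : Lp H 2 halfLine) : Continuous (fun s : ℝ => shift s f) := by
  have h1 : MemLp ((Ici (0 : ℝ)).indicator (⇑f)) 2 volume :=
    (memLp_indicator_iff_restrict measurableSet_Ici).2 (Lp.memLp f)
  have e : (fun s : ℝ => shift s f) = fun s : ℝ => LpToLpRestrictCLM ℝ H ℝ volume 2 (Ici 0)
      (DomAddAct.mk (-s) +ᵥ h1.toLp _) := by
    funext s
    refine Lp.ext ?_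
    refine (MemLp.coeFn_toLp _).trans ?_
    refine EventuallyEq.trans ?_ (LpToLpRestrictCLM_coeFn ℝ _ _).symm
    rw [DomAddAct.mk_vadd_toLp]
    refine EventuallyEq.trans ?_ (ae_restrict_of_ae (MemLp.coeFn_toLp _).symm)
    refine Eventually.of_forall fun r => ?_
    simp [sub_eq_neg_add]
  rw [e]
  have : Fact ((2 : ℝ≥0∞) ≠ ⊤) := ⟨by simp⟩
  refine (LpToLpRestrictCLM ℝ H ℝ volume 2 (Ici 0)).continuous.comp ?_
  exact (DomAddAct.continuous_mk.comp continuous_neg).vadd continuous_const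

lemma laplaceIntegral_shift (f : Lp H 2 halfLine) {s : ℝ} (hs : 0 ≤ s) (l : ℝ) :
    laplaceIntegral (shift s f) l = Real.exp (-(l * s)) • laplaceIntegral f l := by
  have e : laplaceIntegral (shift s f) l
      = laplaceIntegral (fun r => (Ici (0 : ℝ)).indicator (⇑f) (r - s)) l :=
    laplaceIntegral_congr (MemLp.coeFn_toLp _) l
  -- Here `0 ≤ s` enters: for `r < 0` also `r - s < 0`, so nothing is lost on restricting to the
  -- half-line.
  have hz : ∀ r, r ∉ Ici (0 : ℝ) →
      Real.exp (-(l * r)) • (Ici (0 : ℝ)).indicator (⇑f) (r - s) = 0 := fun r hr => by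
    rw [indicator_of_notMem, smul_zero]
    simp only [mem_Ici, not_le] at hr ⊢
    linarith
  rw [e, laplaceIntegral, laplaceIntegral, ← integral_smul, ← integral_Ici_eq_integral_Ioi,
    ← integral_Ici_eq_integral_Ioi, setIntegral_eq_integral_of_forall_compl_eq_zero hz,
    ← integral_indicator measurableSet_Ici, ← integral_add_right_eq_self _ s]
  refine integral_congr_ae (Eventually.of_forall fun r => ?_)
  simp only [indicator, add_sub_cancel_right]
  split_ifs with h
  · rw [smul_smul, ← Real.exp_add]; congr 2; ring
  · rw [smul_zero]

end Generator

section Generator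

variable {H : Type*} [NormedAddCommGroup H] [InnerProductSpace ℝ H]

lemma isLaplaceIntegrable_Lp (f : Lp H 2 halfLine) : IsLaplaceIntegrable f :=
  isLaplaceIntegrable_of_memLp (p := 2) (fun _ => memLp_exp_neg_two) (Lp.memLp f)

lemma memLp_exp_neg_smul {l : ℝ} (hl : 0 < l) (h : H) :
    MemLp (fun t : ℝ => Real.exp (-(l * t)) • h) 2 halfLine :=
  (ContinuousLinearMap.toSpanSingleton ℝ h).comp_memLp' (memLp_exp_neg_two hl)

/-- Tested against `h`, the Laplace transform is an `L²` inner product with a fixed element. It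
therefore commutes with the Bochner integral over `s` and with the limit defining the generator. -/
lemma inner_exp_neg_smul [CompleteSpace H] {l : ℝ} (hl : 0 < l) (h : H) (f : Lp H 2 halfLine) :
    inner ℝ ((memLp_exp_neg_smul hl h).toLp _) f = inner ℝ h (laplaceIntegral f l) := by
  rw [L2.inner_def, laplaceIntegral, ← integral_inner (isLaplaceIntegrable_Lp f l hl),
    ← halfLine_eq]
  refine integral_congr_ae ?_
  filter_upwards [(memLp_exp_neg_smul hl h).coeFn_toLp] with t ht
  rw [ht, real_inner_smul_left, real_inner_smul_right]

lemma laplaceIntegral_subordinatedShift [CompleteSpace H] {β t : ℝ} (h0 : 0 < β) (h1 : β < 1)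
    (ht : 0 < t) (f : Lp H 2 halfLine) {l : ℝ} (hl : 0 < l) :
    laplaceIntegral (subordinatedShift β t f) l
      = Real.exp (-(t * l ^ β)) • laplaceIntegral f l := by
  have hη := isOneSidedStable_stableLaw h0 h1 ht
  have := hη.isProbabilityMeasure
  have hi : Integrable (fun s => shift s f) (stableLaw β t) :=
    Integrable.of_bound (C := ‖f‖) (continuous_shift f).aestronglyMeasurable
      (Eventually.of_forall fun s => norm_shift_le s f)
  refine ext_inner_left ℝ fun h => ?_
  rw [← inner_exp_neg_smul hl, subordinatedShift, ← integral_inner hi]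
  have hpos : ∀ᵐ s ∂(stableLaw β t), 0 ≤ s := by
    rw [ae_iff]
    simpa [Iio] using! hη.measure_Iio
  rw [real_inner_smul_right, ← hη.laplace l hl.le, ← integral_mul_const]
  refine integral_congr_ae (hpos.mono fun s hs => ?_)
  simp only
  rw [inner_exp_neg_smul hl, laplaceIntegral_shift f hs, real_inner_smul_right]

/-- The semigroup acts on transforms as multiplication by `exp (-t l^β)`, whose derivative at `t =
0` is `-l^β`. -/
theorem IsGeneratorValue.laplaceIntegral_eq [CompleteSpace H] {β : ℝ} (h0 : 0 < β) (h1 : β < 1)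
    {f w : Lp H 2 halfLine} (hw : IsGeneratorValue β f w) {l : ℝ} (hl : 0 < l) :
    laplaceIntegral w l = -(l ^ β • laplaceIntegral f l) := by
  refine ext_inner_left ℝ fun h => ?_
  rw [← inner_exp_neg_smul hl]
  have hL := Tendsto.inner (𝕜 := ℝ)
    (tendsto_const_nhds (x := (memLp_exp_neg_smul hl h).toLp _)) hw
  have hd : HasDerivAt (fun t : ℝ => Real.exp (-(t * l ^ β))) (-(l ^ β)) 0 := by
    have := ((hasDerivAt_id (0 : ℝ)).mul_const (l ^ β)).neg.exp
    simpa using this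
  have hR := hd.tendsto_slope_zero_right.mul_const (inner ℝ h (laplaceIntegral f l))
  refine (tendsto_nhds_unique (hL.congr' ?_) hR).trans ?_
  · filter_upwards [self_mem_nhdsWithin] with t ht
    rw [real_inner_smul_right, inner_sub_right, inner_exp_neg_smul hl, inner_exp_neg_smul hl,
      laplaceIntegral_subordinatedShift h0 h1 ht f hl, real_inner_smul_right]
    simp
    ring
  · rw [inner_neg_right, real_inner_smul_right]; ring

/-- For `f` in the domain of the generator, `g_{1-β} * f` is the primitive of `-Λ f`. -/
theorem IsGeneratorValue.rlConv_eq [CompleteSpace H] {β : ℝ} (h0 : 0 < β) (h1 : β < 1)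
    {f w : Lp H 2 halfLine} (hw : IsGeneratorValue β f w) :
    ∀ᵐ t ∂halfLine, rlConv (1 - β) f t = -∫ s in (0 : ℝ)..t, w s :=
  rlConv_eq_neg_primitive h1 (isLaplaceIntegrable_Lp f) (isLaplaceIntegrable_Lp w)
    fun _ hl => hw.laplaceIntegral_eq h0 h1 hl

end Generator

/-! ### Passing to the closure -/

lemma enorm_integral_smul_le {E : Type*} [NormedAddCommGroup E] [NormedSpace ℝ E] {X : Type*}
    [MeasurableSpace X] {μ : Measure X} {p q : ℝ≥0∞} [p.HolderConjugate q] {k : X → ℝ} {f : X → E}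
    (hk : AEStronglyMeasurable k μ) (hf : AEStronglyMeasurable f μ) :
    ‖∫ t, k t • f t ∂μ‖ₑ ≤ eLpNorm k p μ * eLpNorm f q μ :=
  (enorm_integral_le_lintegral_enorm _).trans <|
    (eLpNorm_one_eq_lintegral_enorm (f := k • f)).symm.le.trans
      (eLpNorm_smul_le_mul_eLpNorm hf hk)

lemma memLp_zero_fun {E : Type*} [NormedAddCommGroup E] {p : ℝ≥0∞} {μ : Measure ℝ} :
    MemLp (fun _ => (0 : E)) p μ := MemLp.zero'

lemma eLpNorm_zero_sub_zero {E : Type*} [NormedAddCommGroup E] {p : ℝ≥0∞} {μ : Measure ℝ} :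
    eLpNorm ((fun _ => (0 : E)) - fun _ => 0) p μ = 0 := by simp

section Gelfand

variable {V H : Type*} [NormedAddCommGroup V] [NormedSpace ℝ V]
  [NormedAddCommGroup H] [InnerProductSpace ℝ H] {ι : V →L[ℝ] H} {α β : ℝ}

/-- The embedding `H ≡ H* → V*` as a continuous linear map. -/
noncomputable def toDualCLM (ι : V →L[ℝ] H) : H →L[ℝ] StrongDual ℝ V :=
  ((ContinuousLinearMap.compL ℝ V H ℝ).flip ι).comp (innerSL ℝ)

lemma toDual_eq (ι : V →L[ℝ] H) : toDual ι = toDualCLM ι := rfl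

lemma toDual_apply (h : H) (v : V) : toDual ι h v = inner ℝ h (ι v) := rfl

lemma holderConjugate_ofReal (hα : 1 < α) :
    (ENNReal.ofReal α).HolderConjugate (ENNReal.ofReal (α / (α - 1))) :=
  (Real.HolderConjugate.conjExponent hα).ennrealOfReal

namespace IsDecomp

variable {v : ℝ → StrongDual ℝ V} {a : ℝ → StrongDual ℝ V} {b : ℝ → H}

lemma integrable_smul (hα : 1 < α) (h : IsDecomp ι α v a b) {k : ℝ → ℝ}
    (hk : MemLp k (ENNReal.ofReal α) halfLine) (hk2 : MemLp k 2 halfLine) :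
    Integrable (fun t => k t • v t) halfLine := by
  have := holderConjugate_ofReal hα
  have h1 := memLp_one_iff_integrable.1 (h.memLp.smul (r := 1) hk)
  have h2 := memLp_one_iff_integrable.1
    (((toDualCLM ι).comp_memLp' h.memLp_two).smul (r := 1) hk2)
  refine (h1.add h2).congr (h.ae_eq.mono fun t ht => ?_)
  simp only [ht, smul_add]
  rfl

lemma isLaplaceIntegrable (hα : 1 < α) (h : IsDecomp ι α v a b) : IsLaplaceIntegrable v :=
  fun l hl => by
    have := h.integrable_smul hα (memLp_exp_neg hl (zero_lt_one.trans hα)) (memLp_exp_neg_two hl)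
    rwa [halfLine_eq] at this

/-- Hölder on each summand: a `k` in `L^α ∩ L²` defines a bounded functional on `𝒱*`, with a
constant independent of the decomposition. -/
lemma enorm_integral_smul_le (hα : 1 < α) (h : IsDecomp ι α v a b) {k : ℝ → ℝ}
    (hk : MemLp k (ENNReal.ofReal α) halfLine) (hk2 : MemLp k 2 halfLine) :
    ‖∫ t, k t • v t ∂halfLine‖ₑ ≤
      (eLpNorm k (ENNReal.ofReal α) halfLine + ‖toDualCLM ι‖ₑ * eLpNorm k 2 halfLine)
        * (eLpNorm a (ENNReal.ofReal (α / (α - 1))) halfLine + eLpNorm b 2 halfLine) := by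
  have := holderConjugate_ofReal hα
  have hb := (toDualCLM ι).comp_memLp' h.memLp_two
  have h1 := memLp_one_iff_integrable.1 (h.memLp.smul (r := 1) hk)
  have h2 := memLp_one_iff_integrable.1 (hb.smul (r := 1) hk2)
  have e : ∫ t, k t • v t ∂halfLine
      = (∫ t, k t • a t ∂halfLine) + ∫ t, k t • (toDualCLM ι ∘ b) t ∂halfLine :=
    (integral_congr_ae (h.ae_eq.mono fun t ht => by
      simp only [ht, smul_add]; rfl)).trans (integral_add h1 h2)
  have hb' : eLpNorm (toDualCLM ι ∘ b) 2 halfLine ≤ ‖toDualCLM ι‖ₑ * eLpNorm b 2 halfLine := by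
    rw [← ofReal_norm]
    exact eLpNorm_le_mul_eLpNorm_of_ae_le_mul
      (Eventually.of_forall fun t => (toDualCLM ι).le_opNorm (b t)) 2
  set A := eLpNorm a (ENNReal.ofReal (α / (α - 1))) halfLine
  set B := eLpNorm b 2 halfLine
  calc _ ≤ eLpNorm k (ENNReal.ofReal α) halfLine * A
        + eLpNorm k 2 halfLine * (‖toDualCLM ι‖ₑ * B) := by
        rw [e]
        refine (enorm_add_le _ _).trans (add_le_add
          (TimeFractional.enorm_integral_smul_le hk.1 h.memLp.1) ?_)
        exact (TimeFractional.enorm_integral_smul_le (p := 2) (q := 2) hk2.1 hb.1).trans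
          (mul_le_mul_right hb' _)
    _ ≤ eLpNorm k (ENNReal.ofReal α) halfLine * (A + B)
        + eLpNorm k 2 halfLine * (‖toDualCLM ι‖ₑ * (A + B)) := by
        gcongr
        · exact le_self_add
        · exact le_add_self
    _ = _ := by ring

lemma sub {v' a' : ℝ → StrongDual ℝ V} {b' : ℝ → H} (h : IsDecomp ι α v a b)
    (h' : IsDecomp ι α v' a' b') :
    IsDecomp ι α (fun t => v t - v' t) (a - a') (b - b') where
  memLp := h.memLp.sub h'.memLp
  memLp_two := h.memLp_two.sub h'.memLp_two
  ae_eq := by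
    filter_upwards [h.ae_eq, h'.ae_eq] with t ht ht'
    simp only [ht, ht', Pi.sub_apply, toDual_eq, map_sub]
    abel

end IsDecomp

lemma isDecomp_toDual {b : ℝ → H} (hb : MemLp b 2 halfLine) :
    IsDecomp ι α (fun t => toDual ι (b t)) (fun _ => 0) b where
  memLp := memLp_zero_fun (E := StrongDual ℝ V)
  memLp_two := hb
  ae_eq := Eventually.of_forall fun t => (zero_add (toDual ι (b t))).symm

/-- Convergence in `𝒱*` is expressed by decompositions of the errors; `hv` makes the limit integrand
integrable, so that the integrals may be subtracted. -/
lemma tendsto_integral_smul {κ : Type*} {F : Filter κ} (hα : 1 < α) {v : ℝ → StrongDual ℝ V}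
    {a₀ : ℝ → StrongDual ℝ V} {b₀ : ℝ → H} (hv : IsDecomp ι α v a₀ b₀)
    {v' a : κ → ℝ → StrongDual ℝ V} {b : κ → ℝ → H}
    (h : ∀ n, IsDecomp ι α (fun t => v' n t - v t) (a n) (b n))
    (hlim : Tendsto (fun n => eLpNorm (a n) (ENNReal.ofReal (α / (α - 1))) halfLine
      + eLpNorm (b n) 2 halfLine) F (𝓝 0)) {k : ℝ → ℝ}
    (hk : MemLp k (ENNReal.ofReal α) halfLine) (hk2 : MemLp k 2 halfLine) :
    Tendsto (fun n => ∫ t, k t • v' n t ∂halfLine) F (𝓝 (∫ t, k t • v t ∂halfLine)) := by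
  rw [tendsto_iff_edist_tendsto_0]
  have hC : eLpNorm k (ENNReal.ofReal α) halfLine + ‖toDualCLM ι‖ₑ * eLpNorm k 2 halfLine ≠ ⊤ :=
    ENNReal.add_ne_top.2 ⟨hk.2.ne, ENNReal.mul_ne_top enorm_ne_top hk2.2.ne⟩
  have hl := ENNReal.Tendsto.const_mul hlim (Or.inr hC)
  rw [mul_zero] at hl
  refine tendsto_of_tendsto_of_tendsto_of_le_of_le tendsto_const_nhds hl (fun _ => zero_le)
    fun n => ?_
  have hi := hv.integrable_smul hα hk hk2
  have hi' := (h n).integrable_smul hα hk hk2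
  have e : ∫ t, k t • v' n t ∂halfLine - ∫ t, k t • v t ∂halfLine
      = ∫ t, k t • (v' n t - v t) ∂halfLine := by
    have := integral_add hi' hi
    simp only [smul_sub, sub_add_cancel] at this ⊢
    rw [this, add_sub_cancel_right]
  rw [edist_eq_enorm_sub, e]
  exact (h n).enorm_integral_smul_le hα hk hk2

/-- A sequence in `D(Λ, ℋ) ∩ 𝒱` that approximates the pair `(u, v)` in the graph norm, together
with decompositions of the errors. -/
structure IsApproxSeq (ι : V →L[ℝ] H) (α β : ℝ) (u : ℝ → V) (v : ℝ → StrongDual ℝ V)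
    (ε : ℕ → ℝ≥0∞) (u' : ℕ → ℝ → V) (w : ℕ → Lp H 2 halfLine) (a : ℕ → ℝ → StrongDual ℝ V)
    (b : ℕ → ℝ → H) : Prop where
  tendsto : Tendsto ε atTop (𝓝 0)
  isLambda : ∀ n, IsLambda ι α β (u' n) (w n)
  normV_le : ∀ n, normV ι α (fun t => u' n t - u t) ≤ ε n
  isDecomp : ∀ n, IsDecomp ι α (fun t => toDual ι (w n t) - v t) (a n) (b n)
  norm_le : ∀ n, eLpNorm (a n) (ENNReal.ofReal (α / (α - 1))) halfLine
    + eLpNorm (b n) 2 halfLine ≤ ε n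

lemma IsClosureLambda.exists_approxSeq {u : ℝ → V} {v : ℝ → StrongDual ℝ V}
    (h : IsClosureLambda ι α β u v) :
    ∃ ε u' w a b, IsApproxSeq ι α β u v ε u' w a b := by
  have key : ∀ ε : ℝ≥0∞, 0 < ε → ∃ u' w a b, IsLambda ι α β u' w ∧
      normV ι α (fun t => u' t - u t) < ε ∧ IsDecomp ι α (fun t => toDual ι (w t) - v t) a b ∧
      eLpNorm a (ENNReal.ofReal (α / (α - 1))) halfLine + eLpNorm b 2 halfLine < ε := by
    intro ε hε
    obtain ⟨u', w, h1, h2, h3⟩ := h.2.2 ε hε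
    simp only [normVstar, iInf_lt_iff] at h3
    obtain ⟨a, b, h4, h5⟩ := h3
    exact ⟨u', w, a, b, h1, h2, h4, h5⟩
  -- At `n = 0` the inverse is `⊤`, so no shift of the index is needed.
  have hpos : ∀ n : ℕ, (0 : ℝ≥0∞) < (n : ℝ≥0∞)⁻¹ := fun n => by simp
  choose u' w a b h1 h2 h3 h4 using fun n : ℕ => key _ (hpos n)
  exact ⟨fun n => (n : ℝ≥0∞)⁻¹, u', w, a, b,
    ENNReal.tendsto_inv_nat_nhds_zero, h1, fun n => (h2 n).le, h3, fun n => (h4 n).le⟩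

namespace IsApproxSeq

variable {u : ℝ → V} {v : ℝ → StrongDual ℝ V} {ε : ℕ → ℝ≥0∞} {u' : ℕ → ℝ → V}
  {w : ℕ → Lp H 2 halfLine} {a : ℕ → ℝ → StrongDual ℝ V} {b : ℕ → ℝ → H}

lemma tendsto_integral_lambda (h : IsApproxSeq ι α β u v ε u' w a b) (hα : 1 < α)
    (hv : MemVstar ι α v) {k : ℝ → ℝ}
    (hk : MemLp k (ENNReal.ofReal α) halfLine) (hk2 : MemLp k 2 halfLine) :
    Tendsto (fun n => ∫ t, k t • toDual ι (w n t) ∂halfLine) atTop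
      (𝓝 (∫ t, k t • v t ∂halfLine)) := by
  obtain ⟨a₀, b₀, h₀⟩ := hv
  exact tendsto_integral_smul hα h₀ h.isDecomp
    (tendsto_of_tendsto_of_tendsto_of_le_of_le tendsto_const_nhds h.tendsto
      (fun _ => zero_le) h.norm_le) hk hk2

/-- Only the `L²(H)` part of the norm of `𝒱` is needed, with the decomposition `a = 0`, `b = ι u`.
-/
lemma tendsto_integral (h : IsApproxSeq ι α β u v ε u' w a b) (hα : 1 < α)
    (hu : MemV ι α u) {k : ℝ → ℝ}
    (hk : MemLp k (ENNReal.ofReal α) halfLine) (hk2 : MemLp k 2 halfLine) :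
    Tendsto (fun n => ∫ t, k t • toDual ι (ι (u' n t)) ∂halfLine) atTop
      (𝓝 (∫ t, k t • toDual ι (ι (u t)) ∂halfLine)) := by
  refine tendsto_integral_smul hα (isDecomp_toDual hu.memLp_two)
    (fun n => (isDecomp_toDual (h.isLambda n).1.memLp_two).sub (isDecomp_toDual hu.memLp_two))
    (tendsto_of_tendsto_of_tendsto_of_le_of_le tendsto_const_nhds h.tendsto
      (fun _ => zero_le) fun n => ?_) hk hk2
  refine le_trans ?_ (h.normV_le n)
  rw [eLpNorm_zero_sub_zero, zero_add]
  refine le_trans (le_of_eq ?_) (le_max_right _ _)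
  simp only [map_sub]
  rfl

end IsApproxSeq

lemma laplaceIntegral_toDual [CompleteSpace H] {f : ℝ → H} (hf : IsLaplaceIntegrable f) {l : ℝ}
    (hl : 0 < l) : laplaceIntegral (fun t => toDual ι (f t)) l = toDual ι (laplaceIntegral f l) := by
  rw [toDual_eq, laplaceIntegral, laplaceIntegral,
    ← ContinuousLinearMap.integral_comp_comm _ (hf l hl)]
  simp only [map_smul]

lemma laplaceIntegral_eq_halfLine {E : Type*} [NormedAddCommGroup E] [NormedSpace ℝ E]
    (f : ℝ → E) (l : ℝ) :
    laplaceIntegral f l = ∫ t, Real.exp (-(l * t)) • f t ∂halfLine := by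
  rw [halfLine_eq]; rfl

/-- The Laplace transform of `Λ u` for the closure of `Λ`. -/
theorem IsClosureLambda.laplaceIntegral_eq [CompleteSpace H] (hα : 1 < α) (h0 : 0 < β)
    (h1 : β < 1) {u : ℝ → V} {v : ℝ → StrongDual ℝ V} (h : IsClosureLambda ι α β u v) {l : ℝ}
    (hl : 0 < l) :
    laplaceIntegral v l = -(l ^ β • laplaceIntegral (fun t => toDual ι (ι (u t))) l) := by
  obtain ⟨ε, u', w, a, b, hs⟩ := h.exists_approxSeq
  have hk := memLp_exp_neg hl (zero_lt_one.trans hα)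
  have hk2 := memLp_exp_neg_two hl
  have hA := hs.tendsto_integral_lambda hα h.2.1 hk hk2
  have hB := ((hs.tendsto_integral hα h.1 hk hk2).const_smul (l ^ β)).neg
  simp only [← laplaceIntegral_eq_halfLine] at hA hB
  refine tendsto_nhds_unique hA (hB.congr fun n => ?_)
  obtain ⟨hm, f, hf, hg⟩ := hs.isLambda n
  have hfu : laplaceIntegral (fun t => toDual ι (ι (u' n t))) l
      = laplaceIntegral (fun t => toDual ι (f t)) l :=
    laplaceIntegral_congr (hf.mono fun t ht => by rw [ht]) l
  rw [hfu, laplaceIntegral_toDual (isLaplaceIntegrable_Lp _) hl,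
    laplaceIntegral_toDual (isLaplaceIntegrable_Lp _) hl, hg.laplaceIntegral_eq h0 h1 hl,
    toDual_eq, map_neg, map_smul]

lemma MemV.isLaplaceIntegrable_toDual (hα : 1 < α) {u : ℝ → V} (h : MemV ι α u) :
    IsLaplaceIntegrable (fun t => toDual ι (ι (u t))) :=
  (isDecomp_toDual h.memLp_two).isLaplaceIntegrable hα

lemma MemVstar.isLaplaceIntegrable (hα : 1 < α) {v : ℝ → StrongDual ℝ V} (h : MemVstar ι α v) :
    IsLaplaceIntegrable v :=
  h.elim fun _ h => h.elim fun _ h => h.isLaplaceIntegrable hα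

theorem IsClosureLambda.rlConv_eq [CompleteSpace H] (hα : 1 < α) (h0 : 0 < β)
    (h1 : β < 1) {u : ℝ → V} {v : ℝ → StrongDual ℝ V} (h : IsClosureLambda ι α β u v) :
    ∀ᵐ t ∂halfLine, rlConv (1 - β) (fun t => toDual ι (ι (u t))) t
      = -∫ s in (0 : ℝ)..t, v s :=
  rlConv_eq_neg_primitive h1 (h.1.isLaplaceIntegrable_toDual hα) (h.2.1.isLaplaceIntegrable hα)
    fun _ hl => h.laplaceIntegral_eq hα h0 h1 hl

end Gelfand

/-! ### Integration by parts for primitives -/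

section Parts

variable {E F G : Type*} [NormedAddCommGroup E] [NormedSpace ℝ E] [CompleteSpace E]
  [NormedAddCommGroup F] [NormedSpace ℝ F] [CompleteSpace F]
  [NormedAddCommGroup G] [NormedSpace ℝ G] [CompleteSpace G]

/-- Fubini on the triangle `s < r`. With scalar multiplication it gives the weak derivative of a
primitive, with the inner product the energy identity. -/
theorem integral_bilin_primitive (L : E →L[ℝ] F →L[ℝ] G) {f : ℝ → E} {g : ℝ → F} {T : ℝ}
    (hT : 0 ≤ T) (hf : IntegrableOn f (Ioc 0 T)) (hg : IntegrableOn g (Ioc 0 T)) :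
    ∫ s in (0 : ℝ)..T, L (f s) (∫ r in s..T, g r)
      = ∫ r in (0 : ℝ)..T, L (∫ s in (0 : ℝ)..r, f s) (g r) := by
  have hm : MeasurableSet {z : ℝ × ℝ | z.1 < z.2} := measurableSet_lt measurable_fst measurable_snd
  have hi : Integrable ({z : ℝ × ℝ | z.1 < z.2}.indicator fun z => L (f z.1) (g z.2))
      ((volume.restrict (Ioc 0 T)).prod (volume.restrict (Ioc 0 T))) :=
    (hf.op_fst_snd (op := fun x y => L x y) (by fun_prop) ⟨‖L‖, L.le_opNorm₂⟩ hg).indicator hm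
  have hswap := integral_integral_swap (f := fun s r =>
    {z : ℝ × ℝ | z.1 < z.2}.indicator (fun z => L (f z.1) (g z.2)) (s, r)) hi
  rw [intervalIntegral.integral_of_le hT, intervalIntegral.integral_of_le hT]
  refine Eq.trans ?_ (hswap.trans ?_)
  · refine setIntegral_congr_fun measurableSet_Ioc fun s hs => ?_
    have hsub : Ioc s T ⊆ Ioc 0 T := Ioc_subset_Ioc_left hs.1.le
    rw [intervalIntegral.integral_of_le hs.2,
      ← ContinuousLinearMap.integral_comp_comm _ (hg.mono_set hsub),
      ← inter_eq_right.2 hsub, ← setIntegral_indicator measurableSet_Ioc]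
    refine setIntegral_congr_fun measurableSet_Ioc fun r hr => ?_
    by_cases h : s < r
    · simp [indicator, h, hr.2]
    · simp [indicator, h]
  · refine setIntegral_congr_fun measurableSet_Ioc fun r hr => ?_
    have hsub : Ioo 0 r ⊆ Ioc 0 T := fun s hs => ⟨hs.1, hs.2.le.trans hr.2⟩
    rw [intervalIntegral.integral_of_le hr.1.le, integral_Ioc_eq_integral_Ioo (f := f),
      ← ContinuousLinearMap.flip_apply,
      ← ContinuousLinearMap.integral_comp_comm _ (hf.mono_set hsub),
      ← inter_eq_right.2 hsub, ← setIntegral_indicator measurableSet_Ioo]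
    refine setIntegral_congr_fun measurableSet_Ioc fun s hs => ?_
    by_cases h : s < r
    · simp [indicator, h, hs.1]
    · simp [indicator, h]

omit [CompleteSpace E] in
lemma continuousOn_primitive_Icc {v : ℝ → E} {T : ℝ} (hv : IntegrableOn v (Icc 0 T)) :
    ContinuousOn (fun t => ∫ s in (0 : ℝ)..t, v s) (Icc 0 T) := by
  by_cases hT : 0 ≤ T
  · have := intervalIntegral.continuousOn_primitive_interval (μ := volume) (f := v) (a := 0) (b := T)
      (by rwa [uIcc_of_le hT])
    rwa [uIcc_of_le hT] at this
  · rw [Icc_eq_empty hT]; exact continuousOn_empty _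

/-- A function that is a.e. equal to the primitive of `v` has the weak derivative `v`. -/
theorem hasWeakDerivOn_primitive {U v : ℝ → E} {T : ℝ} (hT : 0 < T)
    (hv : IntegrableOn v (Icc 0 T))
    (hU : ∀ᵐ t ∂volume.restrict (Icc 0 T), U t = ∫ s in (0 : ℝ)..t, v s) :
    HasWeakDerivOn T U v := by
  refine ⟨?_, hv, fun φ hφ hc hs => ?_⟩
  · exact ((continuousOn_primitive_Icc hv).integrableOn_Icc).congr (hU.mono fun t ht => ht.symm)
  have hφT : φ T = 0 := image_eq_zero_of_notMem_tsupport fun h => lt_irrefl _ (hs h).2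
  have hφ' : Continuous (deriv φ) := hφ.continuous_deriv (by simp)
  have hparts := integral_bilin_primitive (ContinuousLinearMap.lsmul ℝ ℝ).flip hT.le
    (hv.mono_set Ioc_subset_Icc_self)
    (hφ'.integrableOn_Icc (a := 0) (b := T) |>.mono_set Ioc_subset_Icc_self)
  simp only [ContinuousLinearMap.flip_apply, ContinuousLinearMap.lsmul_apply] at hparts
  -- As `φ T = 0`, the tail integral of `φ'` is `-φ`, which turns the Fubini identity into the weak
  -- derivative formula.
  have hpr : ∀ s, ∫ r in s..T, deriv φ r = -φ s := fun s => by
    rw [intervalIntegral.integral_deriv_eq_sub (fun x _ => hφ.differentiable (by simp) x)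
      (hφ'.intervalIntegrable _ _), hφT, zero_sub]
  simp only [hpr, neg_smul, intervalIntegral.integral_neg] at hparts
  refine (integral_congr_ae (g := fun t => deriv φ t • ∫ s in (0 : ℝ)..t, v s)
    (hU.mono fun t ht => by simp only [ht])).trans ?_
  rw [integral_Icc_eq_integral_Ioc,
    integral_Icc_eq_integral_Ioc, ← intervalIntegral.integral_of_le hT.le,
    ← intervalIntegral.integral_of_le hT.le, ← hparts]

/-- The integrated form of `(‖D‖²)' = 2 ⟨d, D⟩` for `D = ∫_0^· d`: apply integration by parts to
`∫_s^T d = D(T) - D(s)`. -/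
theorem norm_sq_primitive {H : Type*} [NormedAddCommGroup H] [InnerProductSpace ℝ H]
    [CompleteSpace H] {d : ℝ → H} {T : ℝ} (hT : 0 ≤ T) (hd : IntegrableOn d (Icc 0 T)) :
    ‖∫ s in (0 : ℝ)..T, d s‖ ^ 2 = 2 * ∫ s in (0 : ℝ)..T, inner ℝ (d s) (∫ r in (0 : ℝ)..s, d r) := by
  have hd' := hd.mono_set Ioc_subset_Icc_self
  have hparts : ∫ s in (0 : ℝ)..T, inner ℝ (d s) (∫ r in s..T, d r)
      = ∫ r in (0 : ℝ)..T, inner ℝ (∫ s in (0 : ℝ)..r, d s) (d r) :=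
    integral_bilin_primitive (innerSL ℝ) hT hd' hd'
  have hcont := continuousOn_primitive_Icc hd
  have hint : IntervalIntegrable (fun s => inner ℝ (d s) (∫ r in (0 : ℝ)..s, d r)) volume 0 T := by
    rw [intervalIntegrable_iff_integrableOn_Icc_of_le hT]
    obtain ⟨C, hC⟩ := isCompact_Icc.exists_bound_of_continuousOn hcont
    refine Integrable.mono' (hd.norm.mul_const C) (hd.aestronglyMeasurable.inner
      (hcont.aestronglyMeasurable measurableSet_Icc)) ?_
    filter_upwards [ae_restrict_mem measurableSet_Icc] with s hs
    exact (norm_inner_le_norm _ _).trans (by gcongr; exact hC s hs)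
  have hint' : IntervalIntegrable (fun s => inner ℝ (d s) (∫ r in (0 : ℝ)..T, d r)) volume 0 T := by
    rw [intervalIntegrable_iff_integrableOn_Icc_of_le hT]
    exact hd.inner_const _
  have e1 : ∫ s in (0 : ℝ)..T, inner ℝ (d s) (∫ r in s..T, d r)
      = (∫ s in (0 : ℝ)..T, inner ℝ (d s) (∫ r in (0 : ℝ)..T, d r))
        - ∫ s in (0 : ℝ)..T, inner ℝ (d s) (∫ r in (0 : ℝ)..s, d r) := by
    rw [← intervalIntegral.integral_sub hint' hint]
    refine intervalIntegral.integral_congr fun s hs => ?_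
    rw [uIcc_of_le hT] at hs
    rw [← inner_sub_right, intervalIntegral.integral_interval_sub_left]
    · exact (intervalIntegrable_iff_integrableOn_Icc_of_le hT).2 hd
    · exact (intervalIntegrable_iff_integrableOn_Icc_of_le hs.1).2
        (hd.mono_set (Icc_subset_Icc_right hs.2))
  have e2 : ∫ s in (0 : ℝ)..T, inner ℝ (d s) (∫ r in (0 : ℝ)..T, d r)
      = ‖∫ s in (0 : ℝ)..T, d s‖ ^ 2 := by
    rw [← real_inner_self_eq_norm_sq, intervalIntegral.integral_of_le hT,
      intervalIntegral.integral_of_le hT, ← integral_inner hd']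
    exact integral_congr_ae (Eventually.of_forall fun s => real_inner_comm _ _)
  have e3 : ∫ r in (0 : ℝ)..T, inner ℝ (∫ s in (0 : ℝ)..r, d s) (d r)
      = ∫ s in (0 : ℝ)..T, inner ℝ (d s) (∫ r in (0 : ℝ)..s, d r) :=
    intervalIntegral.integral_congr fun s _ => real_inner_comm _ _
  rw [e1, e2, e3] at hparts
  linarith

end Parts

/-! ### Continuity of `g_{1-β} * u` in `H` -/

section Young

variable {E F : Type*} [NormedAddCommGroup E] [NormedAddCommGroup F]

lemma lintegral_enorm_mul_enorm_le {X : Type*} [MeasurableSpace X] {μ : Measure X} {p q : ℝ≥0∞}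
    [p.HolderConjugate q] {a : X → E} {u : X → F} (ha : AEStronglyMeasurable a μ)
    (hu : AEStronglyMeasurable u μ) :
    ∫⁻ t, ‖a t‖ₑ * ‖u t‖ₑ ∂μ ≤ eLpNorm a p μ * eLpNorm u q μ := by
  have := eLpNorm_smul_le_mul_eLpNorm (p := p) (q := q) (r := 1) hu.norm ha.norm
  rw [eLpNorm_one_eq_lintegral_enorm, eLpNorm_norm, eLpNorm_norm] at this
  simpa [enorm_mul] using this

lemma aemeasurable_lintegral_conv {k : ℝ → ℝ≥0∞} (hk : Measurable k) {u : ℝ → F}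
    (hu : AEStronglyMeasurable u volume) :
    AEMeasurable (fun z : ℝ × ℝ => k z.2 * ‖u (z.1 - z.2)‖ₑ)
      ((volume : Measure ℝ).prod volume) :=
  (hk.comp measurable_snd).aemeasurable.mul
    (hu.comp_quasiMeasurePreserving (quasiMeasurePreserving_sub volume volume)).enorm

/-- Young's inequality for convolutions, in dual form. -/
theorem lintegral_enorm_mul_conv_le {p q : ℝ≥0∞} [p.HolderConjugate q] {k : ℝ → ℝ≥0∞}
    (hk : Measurable k) {a : ℝ → E} {u : ℝ → F} (ha : AEStronglyMeasurable a volume)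
    (hu : AEStronglyMeasurable u volume) :
    ∫⁻ s, ‖a s‖ₑ * ∫⁻ x, k x * ‖u (s - x)‖ₑ
      ≤ (∫⁻ x, k x) * (eLpNorm a p volume * eLpNorm u q volume) := by
  have hm := aemeasurable_lintegral_conv hk hu
  have hs : ∀ x, AEStronglyMeasurable (fun s => u (s - x)) volume := fun x =>
    hu.comp_measurePreserving (measurePreserving_sub_right volume x)
  calc ∫⁻ s, ‖a s‖ₑ * ∫⁻ x, k x * ‖u (s - x)‖ₑ
      = ∫⁻ s, ∫⁻ x, ‖a s‖ₑ * (k x * ‖u (s - x)‖ₑ) := by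
        refine lintegral_congr fun s => (lintegral_const_mul' _ _ enorm_ne_top).symm
    _ = ∫⁻ x, ∫⁻ s, ‖a s‖ₑ * (k x * ‖u (s - x)‖ₑ) :=
        lintegral_lintegral_swap ((ha.enorm.comp_quasiMeasurePreserving
          Measure.quasiMeasurePreserving_fst).mul hm)
    _ = ∫⁻ x, k x * ∫⁻ s, ‖a s‖ₑ * ‖u (s - x)‖ₑ := by
        refine lintegral_congr fun x => ?_
        rw [← lintegral_const_mul'' (k x) (f := fun s => ‖a s‖ₑ * ‖u (s - x)‖ₑ)
          (ha.enorm.mul (hs x).enorm)]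
        exact lintegral_congr fun s => by ring
    -- For each fixed `x`, Hölder and translation invariance bound the inner integral independently
    -- of `x`.
    _ ≤ ∫⁻ x, k x * (eLpNorm a p volume * eLpNorm u q volume) := by
        refine lintegral_mono fun x => mul_le_mul_right ?_ _
        refine (lintegral_enorm_mul_enorm_le (p := p) (q := q) ha (hs x)).trans_eq ?_
        rw [← eLpNorm_comp_measurePreserving hu (measurePreserving_sub_right volume x)]
        rfl
    _ = _ := lintegral_mul_const _ hk

end Young

/-- The mass of the kernel `g_γ` on `[0, T]`. -/
noncomputable def rlMass (γ T : ℝ) : ℝ≥0∞ := ∫⁻ x in Icc 0 T, ‖rlKernel γ x‖ₑ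

lemma measurable_rlKernel (γ : ℝ) : Measurable (rlKernel γ) := by
  unfold rlKernel; fun_prop

lemma rlMass_ne_top {γ : ℝ} (hγ : 0 < γ) (T : ℝ) : rlMass γ T ≠ ⊤ := by
  have h : IsLaplaceIntegrable (rlKernel γ) := fun l hl => (rlKernel_exp_integrable hγ hl).1
  exact (h.integrableOn T).2.ne

/-- A measurable majorant of `‖g_γ * u‖` on `[0, T]`. -/
noncomputable def rlMajorant {F : Type*} [NormedAddCommGroup F] (γ T : ℝ) (u : ℝ → F) (s : ℝ) :
    ℝ≥0∞ :=
  ∫⁻ x, (Icc 0 T).indicator (fun x => ‖rlKernel γ x‖ₑ) x * ‖(Ici (0 : ℝ)).indicator u (s - x)‖ₑ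

section Majorant

variable {E F : Type*} [NormedAddCommGroup E] [NormedAddCommGroup F] {γ : ℝ}

/-- Substitute `x = s - r`. For `s ≤ T` only kernel arguments in `[0, T]` occur, and there the
kernel has finite mass when `γ > 0`. -/
lemma lintegral_rlKernel_le (u : ℝ → F) {s T : ℝ} (hsT : s ≤ T) :
    ∫⁻ r in Ioc 0 s, ‖rlKernel γ (s - r)‖ₑ * ‖u r‖ₑ ≤ rlMajorant γ T u s := by
  rw [rlMajorant, ← lintegral_indicator measurableSet_Ioc, ← lintegral_sub_left_eq_self _ s]
  refine lintegral_mono fun x => ?_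
  by_cases h : s - x ∈ Ioc 0 s
  · have h1 : x ∈ Icc 0 T := ⟨by linarith [h.2], by linarith [h.1]⟩
    have h2 : s - x ∈ Ici (0 : ℝ) := h.1.le
    rw [indicator_of_mem h, indicator_of_mem h1, indicator_of_mem h2, sub_sub_cancel]
  · rw [indicator_of_notMem h]; exact zero_le

lemma measurable_indicator_rlKernel (γ T : ℝ) :
    Measurable ((Icc 0 T).indicator (fun x => ‖rlKernel γ x‖ₑ)) :=
  (measurable_rlKernel γ).enorm.indicator measurableSet_Icc

lemma aemeasurable_rlMajorant {T : ℝ} {u : ℝ → F} (hu : AEStronglyMeasurable u halfLine) :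
    AEMeasurable (rlMajorant γ T u) volume :=
  (aemeasurable_lintegral_conv (measurable_indicator_rlKernel γ T)
    ((aestronglyMeasurable_indicator_iff measurableSet_Ici).2 hu)).lintegral_prod_right'

lemma lintegral_enorm_mul_rlMajorant_le {p q : ℝ≥0∞} [p.HolderConjugate q] {a : ℝ → E} {u : ℝ → F}
    (ha : AEStronglyMeasurable a halfLine) (hu : AEStronglyMeasurable u halfLine) (t T : ℝ) :
    ∫⁻ s in Ioc 0 t, ‖a s‖ₑ * rlMajorant γ T u s
      ≤ rlMass γ T * (eLpNorm a p halfLine * eLpNorm u q halfLine) := by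
  have key := lintegral_enorm_mul_conv_le (p := p) (q := q) (measurable_indicator_rlKernel γ T)
    ((aestronglyMeasurable_indicator_iff measurableSet_Ici).2 ha)
    ((aestronglyMeasurable_indicator_iff measurableSet_Ici).2 hu)
  rw [lintegral_indicator measurableSet_Icc, eLpNorm_indicator_eq_eLpNorm_restrict measurableSet_Ici,
    eLpNorm_indicator_eq_eLpNorm_restrict measurableSet_Ici] at key
  refine le_trans ?_ key
  rw [← lintegral_indicator measurableSet_Ioc]
  refine lintegral_mono fun s => ?_
  by_cases h : s ∈ Ioc 0 t
  · have h2 : s ∈ Ici (0 : ℝ) := h.1.le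
    rw [indicator_of_mem h, indicator_of_mem h2]
    rfl
  · rw [indicator_of_notMem h]; exact zero_le

end Majorant

/-! ### The energy pairing between `𝒱*` and `g_γ * u` -/

section Energy

variable {V H : Type*} [NormedAddCommGroup V] [NormedSpace ℝ V]
  [NormedAddCommGroup H] [InnerProductSpace ℝ H] [CompleteSpace H] {ι : V →L[ℝ] H} {α β γ : ℝ}

lemma enorm_inner_integral_le (h : H) (f : ℝ → H) (μ : Measure ℝ) :
    ‖inner ℝ h (∫ r, f r ∂μ)‖ₑ ≤ ∫⁻ r, ‖inner ℝ h (f r)‖ₑ ∂μ := by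
  by_cases hf : Integrable f μ
  · rw [← integral_inner hf]
    exact enorm_integral_le_lintegral_enorm _
  · simp [integral_undef hf]

/-- The pairing is moved inside the convolution and `d` is split pointwise on `u r ∈ V`; hence the
convolution never has to be formed in `V`. -/
lemma enorm_inner_rlConv_le {d : H} {a : StrongDual ℝ V} {b : H} {u : ℝ → V}
    (hd : toDual ι d = a + toDual ι b) (hu : AEStronglyMeasurable u halfLine) {s T : ℝ}
    (hs : 0 ≤ s) (hsT : s ≤ T) :
    ‖inner ℝ d (rlConv γ (fun r => ι (u r)) s)‖ₑ
      ≤ ‖a‖ₑ * rlMajorant γ T u s + ‖b‖ₑ * rlMajorant γ T (fun r => ι (u r)) s := by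
  have hu' : AEStronglyMeasurable u (volume.restrict (Ioc 0 s)) :=
    hu.mono_measure (Measure.restrict_mono_set _ fun r hr => hr.1.le)
  have hk : Measurable fun r => rlKernel γ (s - r) :=
    (measurable_rlKernel γ).comp (measurable_const.sub measurable_id)
  rw [rlConv, intervalIntegral.integral_of_le hs]
  calc _ ≤ ∫⁻ r in Ioc 0 s, ‖inner ℝ d (rlKernel γ (s - r) • ι (u r))‖ₑ :=
        enorm_inner_integral_le _ _ _
    _ ≤ ∫⁻ r in Ioc 0 s, (‖a‖ₑ * (‖rlKernel γ (s - r)‖ₑ * ‖u r‖ₑ)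
          + ‖b‖ₑ * (‖rlKernel γ (s - r)‖ₑ * ‖ι (u r)‖ₑ)) := by
        refine lintegral_mono fun r => ?_
        have e : inner ℝ d (ι (u r)) = a (u r) + inner ℝ b (ι (u r)) := by
          rw [← toDual_apply, hd]; rfl
        have h1 : ‖a (u r)‖ₑ ≤ ‖a‖ₑ * ‖u r‖ₑ := a.le_opENorm (u r)
        have h2 : ‖inner ℝ b (ι (u r))‖ₑ ≤ ‖b‖ₑ * ‖ι (u r)‖ₑ := by
          simp only [← ofReal_norm, ← ENNReal.ofReal_mul (norm_nonneg _)]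
          exact ENNReal.ofReal_le_ofReal (norm_inner_le_norm _ _)
        rw [real_inner_smul_right, enorm_mul, e]
        calc _ ≤ ‖rlKernel γ (s - r)‖ₑ * (‖a‖ₑ * ‖u r‖ₑ + ‖b‖ₑ * ‖ι (u r)‖ₑ) :=
              mul_le_mul_right ((enorm_add_le _ _).trans (add_le_add h1 h2)) _
          _ = _ := by ring
    _ = ‖a‖ₑ * (∫⁻ r in Ioc 0 s, ‖rlKernel γ (s - r)‖ₑ * ‖u r‖ₑ)
          + ‖b‖ₑ * ∫⁻ r in Ioc 0 s, ‖rlKernel γ (s - r)‖ₑ * ‖ι (u r)‖ₑ := by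
        rw [lintegral_add_left' (f := fun r => ‖a‖ₑ * (‖rlKernel γ (s - r)‖ₑ * ‖u r‖ₑ))
            ((hk.enorm.aemeasurable.mul hu'.enorm).const_mul _),
          lintegral_const_mul' _ _ enorm_ne_top, lintegral_const_mul' _ _ enorm_ne_top]
    _ ≤ _ := by
        gcongr
        · exact lintegral_rlKernel_le u hsT
        · exact lintegral_rlKernel_le (fun r => ι (u r)) hsT

/-- Integrate the pointwise bound and apply Young's inequality twice, with exponents `α/(α-1), α`
for `a` and `2, 2` for `b`. -/
theorem IsDecomp.enorm_integral_inner_rlConv_le (hα : 1 < α) {d : ℝ → H}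
    {a : ℝ → StrongDual ℝ V} {b : ℝ → H} {u : ℝ → V}
    (h : IsDecomp ι α (fun t => toDual ι (d t)) a b) (hu : MemV ι α u) {t T : ℝ} (ht : 0 ≤ t)
    (htT : t ≤ T) :
    ‖∫ s in (0 : ℝ)..t, inner ℝ (d s) (rlConv γ (fun r => ι (u r)) s)‖ₑ
      ≤ rlMass γ T * ((eLpNorm a (ENNReal.ofReal (α / (α - 1))) halfLine + eLpNorm b 2 halfLine)
        * normV ι α u) := by
  have hpq := (holderConjugate_ofReal hα).symm
  have hsub : Ioc 0 t ⊆ Ici (0 : ℝ) := fun r hr => hr.1.le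
  have ha' : AEStronglyMeasurable a (volume.restrict (Ioc 0 t)) :=
    h.memLp.1.mono_measure (Measure.restrict_mono_set _ hsub)
  have hae : ∀ᵐ s ∂volume.restrict (Ioc 0 t), toDual ι (d s) = a s + toDual ι (b s) :=
    ae_mono (Measure.restrict_mono_set _ hsub) h.ae_eq
  rw [intervalIntegral.integral_of_le ht]
  calc _ ≤ ∫⁻ s in Ioc 0 t, ‖inner ℝ (d s) (rlConv γ (fun r => ι (u r)) s)‖ₑ :=
        enorm_integral_le_lintegral_enorm _
    _ ≤ ∫⁻ s in Ioc 0 t, (‖a s‖ₑ * rlMajorant γ T u s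
          + ‖b s‖ₑ * rlMajorant γ T (fun r => ι (u r)) s) := by
        refine lintegral_mono_ae ?_
        filter_upwards [hae, ae_restrict_mem measurableSet_Ioc] with s hs hst
        exact enorm_inner_rlConv_le hs hu.memLp.1 hst.1.le (hst.2.trans htT)
    _ = (∫⁻ s in Ioc 0 t, ‖a s‖ₑ * rlMajorant γ T u s)
          + ∫⁻ s in Ioc 0 t, ‖b s‖ₑ * rlMajorant γ T (fun r => ι (u r)) s :=
        lintegral_add_left' (ha'.enorm.mul (aemeasurable_rlMajorant hu.memLp.1).restrict) _
    _ ≤ rlMass γ T * (eLpNorm a (ENNReal.ofReal (α / (α - 1))) halfLine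
            * eLpNorm u (ENNReal.ofReal α) halfLine)
          + rlMass γ T * (eLpNorm b 2 halfLine * eLpNorm (fun r => ι (u r)) 2 halfLine) :=
        add_le_add (lintegral_enorm_mul_rlMajorant_le h.memLp.1 hu.memLp.1 t T)
          (lintegral_enorm_mul_rlMajorant_le h.memLp_two.1 hu.memLp_two.1 t T)
    _ ≤ rlMass γ T * (eLpNorm a (ENNReal.ofReal (α / (α - 1))) halfLine * normV ι α u)
          + rlMass γ T * (eLpNorm b 2 halfLine * normV ι α u) := by
        gcongr
        · exact le_max_left _ _
        · exact le_max_right _ _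
    _ = _ := by ring

end Energy

/-! ### Uniform convergence of the primitives in `H` -/

section Continuity

variable {V H : Type*} [NormedAddCommGroup V] [NormedSpace ℝ V]
  [NormedAddCommGroup H] [InnerProductSpace ℝ H] [CompleteSpace H] {ι : V →L[ℝ] H} {α β : ℝ}

omit [CompleteSpace H] in
lemma MemV.sub {u u' : ℝ → V} (h : MemV ι α u) (h' : MemV ι α u') :
    MemV ι α (fun t => u t - u' t) :=
  ⟨h.memLp.sub h'.memLp, by simpa only [map_sub] using! h.memLp_two.sub h'.memLp_two⟩

omit [CompleteSpace H] in
lemma normV_sub_le (hα : 1 ≤ α) {u u' : ℝ → V} (h : MemV ι α u) (h' : MemV ι α u') :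
    normV ι α (fun t => u t - u' t) ≤ normV ι α u + normV ι α u' := by
  have hp : 1 ≤ ENNReal.ofReal α := by simpa using hα
  refine max_le ((eLpNorm_sub_le h.memLp.1 h'.memLp.1 hp).trans
    (add_le_add (le_max_left _ _) (le_max_left _ _))) ?_
  simp only [map_sub]
  exact (eLpNorm_sub_le h.memLp_two.1 h'.memLp_two.1 one_le_two).trans
    (add_le_add (le_max_right _ _) (le_max_right _ _))

/-- The energy estimate for the difference of two elements of `D(Λ, ℋ) ∩ 𝒱`. -/
theorem IsLambda.enorm_primitive_sub_sq_le (hα : 1 < α) (h0 : 0 < β) (h1 : β < 1)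
    {u₁ u₂ : ℝ → V} {w₁ w₂ : Lp H 2 halfLine} (hl₁ : IsLambda ι α β u₁ w₁)
    (hl₂ : IsLambda ι α β u₂ w₂) {a : ℝ → StrongDual ℝ V} {b : ℝ → H}
    (h : IsDecomp ι α (fun t => toDual ι (w₁ t - w₂ t)) a b) {t T : ℝ} (ht : 0 ≤ t) (htT : t ≤ T) :
    ‖(∫ s in (0 : ℝ)..t, w₁ s) - ∫ s in (0 : ℝ)..t, w₂ s‖ₑ ^ 2
      ≤ 2 * (rlMass (1 - β) T *
        ((eLpNorm a (ENNReal.ofReal (α / (α - 1))) halfLine + eLpNorm b 2 halfLine)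
          * normV ι α (fun t => u₁ t - u₂ t))) := by
  have hw₁ := isLaplaceIntegrable_Lp w₁
  have hw₂ := isLaplaceIntegrable_Lp w₂
  have hlin : ∀ s, 0 ≤ s → ∫ r in (0 : ℝ)..s, (w₁ r - w₂ r)
      = (∫ r in (0 : ℝ)..s, w₁ r) - ∫ r in (0 : ℝ)..s, w₂ r := fun s hs =>
    intervalIntegral.integral_sub
      ((intervalIntegrable_iff_integrableOn_Icc_of_le hs).2 (hw₁.integrableOn s))
      ((intervalIntegrable_iff_integrableOn_Icc_of_le hs).2 (hw₂.integrableOn s))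
  obtain ⟨hm₁, f₁, hf₁, hg₁⟩ := hl₁
  obtain ⟨hm₂, f₂, hf₂, hg₂⟩ := hl₂
  have hi₁ := isLaplaceIntegrable_Lp f₁
  have hi₂ := isLaplaceIntegrable_Lp f₂
  have hconv := rlConv_eq_neg_primitive h1 (f := fun t => f₁ t - f₂ t) (v := fun t => w₁ t - w₂ t)
    (hi₁.sub hi₂) (hw₁.sub hw₂) fun l hl => by
      rw [laplaceIntegral_sub hw₁ hw₂ hl, laplaceIntegral_sub hi₁ hi₂ hl, hg₁.laplaceIntegral_eq h0 h1 hl,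
        hg₂.laplaceIntegral_eq h0 h1 hl, smul_sub]
      abel
  have hfu : ∀ᵐ t ∂halfLine, f₁ t - f₂ t = ι (u₁ t - u₂ t) := by
    filter_upwards [hf₁, hf₂] with t e₁ e₂
    rw [e₁, e₂, map_sub]
  -- The inner primitive is replaced by `-(g_{1-β} * (u₁ - u₂))`, which turns the energy identity
  -- into a pairing of `𝒱*` with `𝒱`.
  have hint : ∫ s in (0 : ℝ)..t, inner ℝ (w₁ s - w₂ s) (∫ r in (0 : ℝ)..s, (w₁ r - w₂ r))
      = -∫ s in (0 : ℝ)..t, inner ℝ (w₁ s - w₂ s)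
        (rlConv (1 - β) (fun r => ι (u₁ r - u₂ r)) s) := by
    rw [← intervalIntegral.integral_neg]
    refine intervalIntegral.integral_congr_ae ((ae_halfLine_iff.1 hconv).mono fun s hs hst => ?_)
    rw [uIoc_of_le ht] at hst
    rw [← rlConv_congr hfu hst.1.le, hs hst.1, inner_neg_right, neg_neg]
  have hsq := norm_sq_primitive ht (d := fun s => w₁ s - w₂ s)
    ((hw₁.integrableOn t).sub (hw₂.integrableOn t))
  rw [hint, hlin t ht] at hsq
  have henergy := h.enorm_integral_inner_rlConv_le hα (hm₁.sub hm₂) (γ := 1 - β) ht htT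
  have e : ‖(∫ s in (0 : ℝ)..t, w₁ s) - ∫ s in (0 : ℝ)..t, w₂ s‖ₑ ^ 2
      = 2 * ‖∫ s in (0 : ℝ)..t, inner ℝ (w₁ s - w₂ s)
        (rlConv (1 - β) (fun r => ι (u₁ r - u₂ r)) s)‖ₑ := by
    rw [← enorm_norm, ← enorm_pow, hsq, enorm_mul, enorm_neg]
    congr 1
    simp [← ofReal_norm]
  rw [e]
  gcongr

namespace IsApproxSeq

variable {u : ℝ → V} {v : ℝ → StrongDual ℝ V} {ε : ℕ → ℝ≥0∞} {u' : ℕ → ℝ → V}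
  {w : ℕ → Lp H 2 halfLine} {a : ℕ → ℝ → StrongDual ℝ V} {b : ℕ → ℝ → H}

/-- The unknowns `u` and `v` cancel in the differences, leaving only errors; the bound does not
depend on `t ∈ [0, T]`. -/
lemma enorm_primitive_sub_sq_le (h : IsApproxSeq ι α β u v ε u' w a b) (hα : 1 < α) (h0 : 0 < β)
    (h1 : β < 1) (hu : MemV ι α u) (n m : ℕ) {t T : ℝ} (ht : 0 ≤ t) (htT : t ≤ T) :
    ‖(∫ s in (0 : ℝ)..t, w n s) - ∫ s in (0 : ℝ)..t, w m s‖ₑ ^ 2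
      ≤ 2 * (rlMass (1 - β) T * ((ε n + ε m) * (ε n + ε m))) := by
  have hd : IsDecomp ι α (fun t => toDual ι (w n t - w m t)) (a n - a m) (b n - b m) := by
    have := (h.isDecomp n).sub (h.isDecomp m)
    simpa only [sub_sub_sub_cancel_right, toDual_eq, map_sub] using this
  refine ((h.isLambda n).enorm_primitive_sub_sq_le hα h0 h1 (h.isLambda m) hd ht htT).trans ?_
  have hq : 1 ≤ ENNReal.ofReal (α / (α - 1)) := by
    rw [ENNReal.one_le_ofReal, one_le_div (by linarith)]; linarith
  refine mul_le_mul_right (mul_le_mul_right (mul_le_mul' ?_ ?_) _) _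
  · calc _ ≤ (eLpNorm (a n) (ENNReal.ofReal (α / (α - 1))) halfLine
            + eLpNorm (a m) (ENNReal.ofReal (α / (α - 1))) halfLine)
          + (eLpNorm (b n) 2 halfLine + eLpNorm (b m) 2 halfLine) :=
          add_le_add (eLpNorm_sub_le (h.isDecomp n).memLp.1 (h.isDecomp m).memLp.1 hq)
            (eLpNorm_sub_le (h.isDecomp n).memLp_two.1 (h.isDecomp m).memLp_two.1 one_le_two)
      _ = _ := add_add_add_comm _ _ _ _
      _ ≤ _ := add_le_add (h.norm_le n) (h.norm_le m)
  · have e : (fun t => u' n t - u' m t) = fun t => (u' n t - u t) - (u' m t - u t) := by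
      funext t; abel
    rw [e]
    exact (normV_sub_le hα.le ((h.isLambda n).1.sub hu) ((h.isLambda m).1.sub hu)).trans
      (add_le_add (h.normV_le n) (h.normV_le m))

lemma uniformCauchySeqOn_primitive (h : IsApproxSeq ι α β u v ε u' w a b)
    (hα : 1 < α) (h0 : 0 < β) (h1 : β < 1) (hu : MemV ι α u) (T : ℝ) :
    UniformCauchySeqOn (fun n t => ∫ s in (0 : ℝ)..t, w n s) atTop (Icc 0 T) := by
  have h1' : Tendsto (fun z : ℕ × ℕ => ε z.1 + ε z.2) (atTop ×ˢ atTop) (𝓝 (0 + 0)) :=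
    (h.tendsto.comp tendsto_fst).add (h.tendsto.comp tendsto_snd)
  rw [add_zero] at h1'
  have h2 : Tendsto (fun z : ℕ × ℕ => (ε z.1 + ε z.2) * (ε z.1 + ε z.2)) (atTop ×ˢ atTop)
      (𝓝 (0 * 0)) := ENNReal.Tendsto.mul h1' (Or.inr (by simp)) h1' (Or.inr (by simp))
  have h3 := ENNReal.Tendsto.const_mul (ENNReal.Tendsto.const_mul h2
    (Or.inr (rlMass_ne_top (sub_pos.2 h1) T))) (Or.inr (ENNReal.ofNat_ne_top (n := 2)))
  simp only [mul_zero] at h3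
  intro U hU
  obtain ⟨δ, hδ, hsub⟩ := mem_uniformity_edist.1 hU
  filter_upwards [h3.eventually_lt_const (ENNReal.pow_pos hδ 2)] with z hz t ht
  refine hsub ?_
  rw [edist_eq_enorm_sub]
  exact lt_of_pow_lt_pow_left' 2
    ((h.enorm_primitive_sub_sq_le hα h0 h1 hu z.1 z.2 ht.1 ht.2).trans_lt hz)

/-- The test function is the indicator of `(0, t]`, which lies in every `L^p`. -/
lemma tendsto_primitive (h : IsApproxSeq ι α β u v ε u' w a b) (hα : 1 < α)
    (hv : MemVstar ι α v) {t : ℝ} (ht : 0 ≤ t) :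
    Tendsto (fun n => toDual ι (∫ s in (0 : ℝ)..t, w n s)) atTop
      (𝓝 (∫ s in (0 : ℝ)..t, v s)) := by
  have hk : ∀ p : ℝ≥0∞, MemLp ((Ioc 0 t).indicator fun _ => (1 : ℝ)) p halfLine := fun p =>
    memLp_indicator_const p measurableSet_Ioc 1
      (Or.inr ((Measure.restrict_apply_le _ _).trans_lt measure_Ioc_lt_top).ne)
  have := h.tendsto_integral_lambda hα hv (hk _) (hk _)
  have e : ∀ f : ℝ → StrongDual ℝ V,
      ∫ s, (Ioc 0 t).indicator (fun _ => (1 : ℝ)) s • f s ∂halfLine = ∫ s in (0 : ℝ)..t, f s := by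
    intro f
    have e1 : (fun s => (Ioc 0 t).indicator (fun _ => (1 : ℝ)) s • f s) = (Ioc 0 t).indicator f := by
      funext s
      by_cases hs : s ∈ Ioc 0 t <;> simp [hs]
    rw [e1, halfLine, intervalIntegral.integral_of_le ht, setIntegral_indicator measurableSet_Ioc,
      inter_eq_right.2 fun r hr => hr.1.le]
  simp only [e] at this
  refine this.congr fun n => ?_
  exact (toDualCLM ι).intervalIntegral_comp_comm
    ((intervalIntegrable_iff_integrableOn_Icc_of_le ht).2
      ((isLaplaceIntegrable_Lp (w n)).integrableOn t))

end IsApproxSeq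

theorem IsClosureLambda.exists_continuousOn (hα : 1 < α) (h0 : 0 < β) (h1 : β < 1) {u : ℝ → V}
    {v : ℝ → StrongDual ℝ V} (h : IsClosureLambda ι α β u v) :
    ∃ W : ℝ → H, ContinuousOn W (Ici 0) ∧
      ∀ t, 0 ≤ t → toDual ι (W t) = -∫ s in (0 : ℝ)..t, v s := by
  obtain ⟨ε, u', w, a, b, hs⟩ := h.exists_approxSeq
  have hc := hs.uniformCauchySeqOn_primitive hα h0 h1 h.1
  have hlim : ∀ t, ∃ y : H, 0 ≤ t → Tendsto (fun n => ∫ s in (0 : ℝ)..t, w n s) atTop (𝓝 y) := by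
    intro t
    by_cases ht : 0 ≤ t
    · exact (cauchySeq_tendsto_of_complete ((hc t).cauchySeq ⟨ht, le_rfl⟩)).imp fun y hy _ => hy
    · exact ⟨0, fun h => absurd h ht⟩
  choose W hW using hlim
  -- `W` is the limit of the primitives of `w n`; the sign is that of `Λ u = -(g_{1-β} * u)'`.
  refine ⟨fun t => -W t, ContinuousOn.neg fun t ht => ?_, fun t ht => ?_⟩
  -- The endpoint `t + 1` makes `[0, t + 1]` a neighbourhood of `t` within `[0, ∞)`.
  · have hu := (hc (t + 1)).tendstoUniformlyOn_of_tendsto (f := W) fun s hs => hW s hs.1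
    have hcont : ContinuousOn W (Icc 0 (t + 1)) :=
      hu.continuousOn (Eventually.of_forall fun n =>
        continuousOn_primitive_Icc ((isLaplaceIntegrable_Lp (w n)).integrableOn _)).frequently
    refine (hcont t ⟨ht, by linarith⟩).mono_of_mem_nhdsWithin ?_
    filter_upwards [self_mem_nhdsWithin, mem_nhdsWithin_of_mem_nhds (Iio_mem_nhds (lt_add_one t))]
      with s h1 h2 using ⟨h1, le_of_lt h2⟩
  · have h2 := ((toDualCLM ι).continuous.tendsto _).comp (hW t ht)
    have := tendsto_nhds_unique h2 (hs.tendsto_primitive hα h.2.1 ht)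
    rw [toDual_eq, map_neg, this]

end Continuity

end TimeFractional

end

theorem proposition2p6
    {V H : Type*} [NormedAddCommGroup V] [NormedSpace ℝ V] [CompleteSpace V]
    [NormedAddCommGroup H] [InnerProductSpace ℝ H] [CompleteSpace H]
    [TopologicalSpace.SeparableSpace H]
    (hrefl : Function.Surjective (NormedSpace.inclusionInDoubleDual ℝ V))
    (ι : V →L[ℝ] H) (hinj : Function.Injective ι) (hdense : DenseRange ι)
    {α β : ℝ} (hα : 1 < α) (hβ0 : 0 < β) (hβ1 : β < 1)
    (u : ℝ → V) (hu : TimeFractional.MemF ι α β u) :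
    TimeFractional.MemCaputoDomain β (fun t => TimeFractional.toDual ι (ι (u t))) ∧
    (∀ v : ℝ → StrongDual ℝ V, TimeFractional.IsClosureLambda ι α β u v →
      ∀ T : ℝ, 0 < T →
        TimeFractional.HasWeakDerivOn T
          (TimeFractional.rlConv (1 - β) (fun t => TimeFractional.toDual ι (ι (u t))))
          (fun t => -v t)) ∧
    (∃ w : ℝ → H, ContinuousOn w (Set.Ici 0) ∧
      ∀ᵐ t ∂TimeFractional.halfLine,
        TimeFractional.toDual ι (w t) =
          TimeFractional.rlConv (1 - β) (fun t => TimeFractional.toDual ι (ι (u t))) t) := by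
  have key : ∀ v : ℝ → StrongDual ℝ V, TimeFractional.IsClosureLambda ι α β u v →
      ∀ T : ℝ, 0 < T →
        TimeFractional.HasWeakDerivOn T
          (TimeFractional.rlConv (1 - β) (fun t => TimeFractional.toDual ι (ι (u t))))
          (fun t => -v t) := by
    intro v hv T hT
    refine TimeFractional.hasWeakDerivOn_primitive hT
      ((hv.2.1.isLaplaceIntegrable hα).integrableOn T).neg ?_
    have hsub : Set.Icc 0 T ⊆ Set.Ici (0 : ℝ) := Set.Icc_subset_Ici_self
    filter_upwards [MeasureTheory.ae_mono (MeasureTheory.Measure.restrict_mono_set _ hsub)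
      (hv.rlConv_eq hα hβ0 hβ1)] with t ht
    rw [ht, intervalIntegral.integral_neg]
  obtain ⟨v, hv⟩ := hu
  refine ⟨⟨fun T _ => (hv.1.isLaplaceIntegrable_toDual hα).integrableOn T,
    fun T hT => ⟨_, key v hv T hT⟩⟩, key, ?_⟩
  obtain ⟨W, hW, hWv⟩ := hv.exists_continuousOn hα hβ0 hβ1
  refine ⟨W, hW, ?_⟩
  filter_upwards [hv.rlConv_eq hα hβ0 hβ1,
    MeasureTheory.ae_restrict_mem measurableSet_Ici] with t ht h0
  rw [hWv t h0, ht]
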